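/- Let $f$ be a transcendental entire function (an entire function that is not a polynomial) with $n$-fold iterates $f^n$. The Fatou set of $f$ is the set of points with a neighbourhood on which every sequence of iterates of $f$ has a subsequence converging locally uniformly to a holomorphic function or to $\infty$; its connected components are the Fatou components. A Fatou component $U$ is a wandering domain if $f^n(U)\cap f^m(U)=\varnothing$ for all $n\ne m$. It is oscillating if both $\infty$ and some finite value are locally uniform limits on $U$ of subsequences of $(f^n)$. A wandering domain $U$ is eventually isometric if it is simply connected and there is $N>0$ such that, for all $z,z'\in U$ with $f^k(z)\neq f^k(z')$ for every $k\in\mathbb N$, there is a constant $c(z,z')>0$ with $d_{V_n}(f^n(z),f^n(z'))=c(z,z')$ for all $n\ge N$, where $V_n$ is the Fatou component containing $f^n(U)$ and $d_{V_n}$ is its hyperbolic distance. Let $(U_n)_{n\ge 0}$ be a sequence of eventually isometric oscillating wandering domains of $f$ with $f(U_n)\subset U_{n+1}$ for all $n\geq 0$. Then: (a) there is $N\ge 0$ such that $f|_{U_n}$ is injective for every $n\ge N$; (b) for every $N\ge 0$ such that $f|_{U_n}$ is injective for all $n\ge N$, the set of all entire functions $g$ that are $H(M)$-universal for the composition operator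 $C_f\colon g\mapsto g\circ f$, where $M=\bigcup_{n\ge N}U_n$, is comeagre in $H(\mathbb C)$, i.e. contains a dense $G_\delta$ subset of $H(\mathbb C)$. Here $H(\mathbb C)$ is the space of entire functions with the topology of locally uniform convergence, and $g$ is $H(M)$-universal for $C_f$ if every holomorphic function on $M$ is a limit, locally uniformly on $M$, of a sequence of functions from $\{g\circ f^n|_M : n\in\mathbb N\}$. In particular, if $f|_{U_n}$ is injective for every $n\ge 0$, the set of all entire functions that are $H(\bigcup_{n\ge 0}U_n)$-universal for $C_f$ is comeagre in $H(\mathbb C)$. -/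

import Mathlib

open Filter Topology

noncomputable section

/-- A transcendental entire function: holomorphic on the whole plane and not a polynomial. -/
def IsTranscendentalEntire (f : ℂ → ℂ) : Prop :=
  Differentiable ℂ f ∧ ¬ ∃ p : Polynomial ℂ, ∀ z, f z = p.eval z

/-- The sequence `F` converges to infinity locally uniformly on `V`, i.e. uniformly on every compact
subset of the open set `V`. -/
def TendsToInftyLocallyUniformlyOn (F : ℕ → ℂ → ℂ) (V : Set ℂ) : Prop :=
  ∀ K ⊆ V, IsCompact K → ∀ R : ℝ, ∀ᶠ j in atTop, ∀ z ∈ K, R < ‖F j z‖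

/-- The iterates of `f` form a normal family on `V`: every sequence of iterates has a subsequence
that converges locally uniformly on `V` to a holomorphic function or to infinity. -/
def IteratesNormalOn (f : ℂ → ℂ) (V : Set ℂ) : Prop :=
  ∀ k : ℕ → ℕ, ∃ φ : ℕ → ℕ, StrictMono φ ∧
    ((∃ g : ℂ → ℂ, DifferentiableOn ℂ g V ∧
        TendstoLocallyUniformlyOn (fun j => f^[k (φ j)]) g atTop V) ∨
      TendsToInftyLocallyUniformlyOn (fun j => f^[k (φ j)]) V)

/-- The Fatou set: the points with a neighbourhood on which the iterates form a normal family. -/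
def fatouSet (f : ℂ → ℂ) : Set ℂ :=
  {z | ∃ V : Set ℂ, IsOpen V ∧ z ∈ V ∧ IteratesNormalOn f V}

/-- The Fatou component containing the point `z` of the Fatou set. -/
def fatouComponent (f : ℂ → ℂ) (z : ℂ) : Set ℂ :=
  connectedComponentIn (fatouSet f) z

/-- `U` is a Fatou component, i.e. a connected component of the Fatou set. -/
def IsFatouComponent (f : ℂ → ℂ) (U : Set ℂ) : Prop :=
  ∃ z ∈ fatouSet f, U = fatouComponent f z

/-- A wandering domain: a Fatou component whose images under the iterates are pairwise disjoint. -/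
def IsWanderingDomain (f : ℂ → ℂ) (U : Set ℂ) : Prop :=
  IsFatouComponent f U ∧ ∀ n m : ℕ, n ≠ m → Disjoint (f^[n] '' U) (f^[m] '' U)

/-- An oscillating wandering domain: both infinity and some finite value are limit functions of
subsequences of the iterates on `U`. -/
def IsOscillatingWanderingDomain (f : ℂ → ℂ) (U : Set ℂ) : Prop :=
  IsWanderingDomain f U ∧
    (∃ φ : ℕ → ℕ, StrictMono φ ∧ TendsToInftyLocallyUniformlyOn (fun j => f^[φ j]) U) ∧
    (∃ a : ℂ, ∃ φ : ℕ → ℕ, StrictMono φ ∧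
      TendstoLocallyUniformlyOn (fun j => f^[φ j]) (fun _ => a) atTop U)

/-- `π`, restricted to the upper half-plane, is a holomorphic universal covering of `U`. -/
def IsHolomorphicUniversalCover (π : ℂ → ℂ) (U : Set ℂ) : Prop :=
  DifferentiableOn ℂ π {a | 0 < a.im} ∧
    Set.range (fun a : UpperHalfPlane => π a) = U ∧
    IsCoveringMapOn (fun a : UpperHalfPlane => π a) U

/-- The hyperbolic distance of a hyperbolic domain `U`: the quotient of the hyperbolic distance of the
upper half-plane (curvature `-1`) under a holomorphic universal covering. Any two such coverings
differ by an isometry of the half-plane, so the infimum does not depend on the choice of `π`. -/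
def hyperbolicDist (U : Set ℂ) (z w : ℂ) : ℝ :=
  sInf {t | ∃ π : ℂ → ℂ, IsHolomorphicUniversalCover π U ∧
    ∃ a b : UpperHalfPlane, π a = z ∧ π b = w ∧ t = dist a b}

/-- A (hyperbolically) eventually isometric wandering domain: `U` is simply connected and, from some
time `N` on, the hyperbolic distance of `f^n(z)` and `f^n(z')` in the Fatou component `U_n` containing
`f^n(U)` is a positive constant `c(z, z')`, for all `z, z' ∈ U` whose orbits never meet. -/
def IsEventuallyIsometricWanderingDomain (f : ℂ → ℂ) (U : Set ℂ) : Prop :=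
  IsWanderingDomain f U ∧ IsSimplyConnected U ∧
    ∃ N : ℕ, 0 < N ∧ ∀ z ∈ U, ∀ z' ∈ U, (∀ k : ℕ, f^[k] z ≠ f^[k] z') →
      ∃ c : ℝ, 0 < c ∧ ∀ n ≥ N,
        hyperbolicDist (fatouComponent f (f^[n] z)) (f^[n] z) (f^[n] z') = c

/-- The space `H(ℂ)` of entire functions; its topology, inherited from the compact-open topology of
`C(ℂ, ℂ)`, is that of locally uniform convergence. -/
abbrev EntireFunctions : Type := {g : C(ℂ, ℂ) // Differentiable ℂ g}

/-- The holomorphic functions `H(M)` on an open set `M`, as a subset of `C(M)`. -/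
def holomorphicFunctions (M : Set ℂ) : Set C(M, ℂ) :=
  {h | ∃ H : ℂ → ℂ, DifferentiableOn ℂ H M ∧ ∀ z : M, h z = H z}

/-- `g` is `𝓕`-universal for the composition operator `C_f`: the family `𝓕 ⊆ C(M)` is contained in the
closure in `C(M)` (compact-open topology) of the restrictions to `M` of `g ∘ f^n`, `n ∈ ℕ`. -/
def IsUniversalForComposition (f : ℂ → ℂ) {M : Set ℂ} (𝓕 : Set C(M, ℂ)) (g : EntireFunctions) :
    Prop :=
  𝓕 ⊆ closure {φ : C(M, ℂ) | ∃ n : ℕ, ∀ z : M, φ z = g.1 (f^[n] z)}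

/-- A subset of a Baire space is comeagre if it contains a dense `G_δ` set. -/
def IsComeagre {X : Type*} [TopologicalSpace X] (S : Set X) : Prop :=
  ∃ G ⊆ S, IsGδ G ∧ Dense G

end

/-! (a) Take two points of `U 0` whose orbits never meet. From some time on their hyperbolic
distance is constant and positive, so `f : U n → U (n + 1)` preserves one positive distance. Lifted
to half-planes, this is the equality case of Schwarz–Pick (`schwarzPick_upperHalfPlane`), which
forces injectivity (`injOn_of_hyperbolicDist_eq`).

(b) By Birkhoff's transitivity argument in the Baire space of entire functions, it suffices to find
a polynomial `p` close to a given `g₀` on a disc with `p ∘ f^n` close to a given `H` on a compact `K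
⊆ M`. Choose `n` with `f^n(K)` off the disc. As `f^n` is injective on `M`, the second demand is that
`p` approximate `H ∘ (f^n)⁻¹` on `f^n(K)`. Runge's theorem gives `p` once disc and filled image are
disjoint. The filled image stays inside `f^n(M)` because the `U n` are simply connected, and it
cannot meet the disc because the disc, enlarged if necessary, contains a point outside all `U n`.

Plane topology enters through continuous logarithms of `z - w` (Eilenberg's criterion). Runge's
theorem follows from the Cauchy–Pompeiu formula, read as an integral in the uniform closure of the
polynomials. -/

/-! ### Inverses of injective holomorphic functions. -/

/-- An injective holomorphic function on an open set is open. -/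
theorem isOpen_image_of_injOn_differentiableOn {F : ℂ → ℂ} {M : Set ℂ} (hM : IsOpen M)
    (hF : DifferentiableOn ℂ F M) (hinj : Set.InjOn F M) {V : Set ℂ} (hV : IsOpen V)
    (hVM : V ⊆ M) : IsOpen (F '' V) := by
  rw [isOpen_iff_mem_nhds]
  rintro _ ⟨z, hz, rfl⟩
  have hzM := hVM hz
  rcases (hF.analyticAt (hM.mem_nhds hzM)).eventually_constant_or_nhds_le_map_nhds with h | h
  · exfalso
    have h1 : ∀ᶠ w in 𝓝[≠] z, F w = F z ∧ w ∈ M ∧ w ≠ z :=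
      (h.filter_mono nhdsWithin_le_nhds).and
        (Filter.Eventually.and (nhdsWithin_le_nhds (hM.mem_nhds hzM)) self_mem_nhdsWithin)
    obtain ⟨w, h1, h2, h3⟩ := h1.exists
    exact h3 (hinj h2 hzM h1)
  · exact h (image_mem_map (hV.mem_nhds hz))

/-- The inverse of an injective holomorphic function on an open set is continuous. -/
theorem continuousOn_invFunOn_image {F : ℂ → ℂ} {M : Set ℂ} (hM : IsOpen M)
    (hF : DifferentiableOn ℂ F M) (hinj : Set.InjOn F M) :
    ContinuousOn (Function.invFunOn F M) (F '' M) := by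
  rintro _ ⟨z, hz, rfl⟩
  refine ContinuousAt.continuousWithinAt ?_
  have hGz : Function.invFunOn F M (F z) = z := hinj.leftInvOn_invFunOn hz
  rw [ContinuousAt, hGz]
  intro W hW
  obtain ⟨V, hVW, hVo, hzV⟩ := mem_nhds_iff.1 hW
  have := (isOpen_image_of_injOn_differentiableOn hM hF hinj (hVo.inter hM)
    Set.inter_subset_right).mem_nhds (Set.mem_image_of_mem F ⟨hzV, hz⟩)
  rw [mem_map]
  filter_upwards [this]
  rintro _ ⟨w, hw, rfl⟩
  rw [Set.mem_preimage, hinj.leftInvOn_invFunOn hw.2]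
  exact hVW hw.1

/-- The inverse of an injective holomorphic function on an open set is holomorphic. -/
theorem differentiableOn_invFunOn_image {F : ℂ → ℂ} {M : Set ℂ} (hM : IsOpen M)
    (hF : DifferentiableOn ℂ F M) (hinj : Set.InjOn F M) :
    DifferentiableOn ℂ (Function.invFunOn F M) (F '' M) := by
  set G := Function.invFunOn F M with hG
  have hGF : ∀ z ∈ M, G (F z) = z := fun z hz => hinj.leftInvOn_invFunOn hz
  have hopen := isOpen_image_of_injOn_differentiableOn hM hF hinj hM subset_rfl
  have hcont := continuousOn_invFunOn_image hM hF hinj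
  have key : ∀ z ∈ M, deriv F z ≠ 0 → DifferentiableAt ℂ G (F z) := by
    intro z hz hd
    have hnh := hopen.mem_nhds (Set.mem_image_of_mem F hz)
    refine (HasDerivAt.of_local_left_inverse (f := F) (f' := deriv F z)
      (hcont.continuousAt hnh) ?_ hd ?_).differentiableAt
    · rw [← hG, hGF z hz]
      exact (hF.differentiableAt (hM.mem_nhds hz)).hasDerivAt
    · filter_upwards [hnh]
      rintro _ ⟨w, hw, rfl⟩
      rw [← hG, hGF w hw]
  rintro _ ⟨z, hz, rfl⟩
  refine DifferentiableAt.differentiableWithinAt ?_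
  have han : AnalyticAt ℂ F z := hF.analyticAt (hM.mem_nhds hz)
  -- No need to show that `F'` never vanishes: its zeros are isolated, so `G` is holomorphic on a
  -- punctured neighbourhood of `F z`, and continuity removes the singularity.
  have hpunct : ∀ᶠ w in 𝓝[≠] z, deriv F w ≠ 0 := by
    rcases han.deriv.eventually_eq_zero_or_eventually_ne_zero with h | h
    · exfalso
      obtain ⟨r, hr, hball⟩ := Metric.eventually_nhds_iff_ball.1 (h.and (hM.mem_nhds hz))
      have hconst : ∀ w ∈ Metric.ball z r, F w = F z := fun w hw =>
        (convex_ball z r).is_const_of_fderivWithin_eq_zero (𝕜 := ℂ) (f := F)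
          (fun x hx => (hF.differentiableAt (hM.mem_nhds (hball x hx).2)).differentiableWithinAt)
          (fun x hx => by
            rw [fderivWithin_of_isOpen Metric.isOpen_ball hx]
            ext
            simpa using (hball x hx).1) hw (Metric.mem_ball_self hr)
      have h1 : ∀ᶠ w in 𝓝[≠] z, w ∈ Metric.ball z r ∧ w ≠ z :=
        Filter.Eventually.and (nhdsWithin_le_nhds (Metric.ball_mem_nhds z hr)) self_mem_nhdsWithin
      obtain ⟨w, h1, h3⟩ := h1.exists
      exact h3 (hinj (hball w h1).2 hz (hconst w h1))
    · exact h
  obtain ⟨W, hWz, hW⟩ := mem_nhdsWithin_iff_exists_mem_nhds_inter.1 hpunct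
  obtain ⟨V, hVW, hVo, hzV⟩ := mem_nhds_iff.1 hWz
  have himg : F '' (V ∩ M) ∈ 𝓝 (F z) :=
    (isOpen_image_of_injOn_differentiableOn hM hF hinj (hVo.inter hM)
      Set.inter_subset_right).mem_nhds (Set.mem_image_of_mem F ⟨hzV, hz⟩)
  refine DifferentiableOn.differentiableAt
    ((Complex.differentiableOn_compl_singleton_and_continuousAt_iff himg).1 ⟨?_, ?_⟩) himg
  · rintro _ ⟨⟨w, hw, rfl⟩, hne⟩
    refine (key w hw.2 (hW ⟨hVW hw.1, fun h => hne ?_⟩)).differentiableWithinAt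
    rw [Set.mem_singleton_iff] at h
    rw [h]; rfl
  · exact hcont.continuousAt (hopen.mem_nhds (Set.mem_image_of_mem F hz))

/-! ### Continuous logarithms and Eilenberg's criterion. -/

/-- `g` has a continuous logarithm on `K`. -/
def HasContinuousLogOn (g : ℂ → ℂ) (K : Set ℂ) : Prop :=
  ∃ l : ℂ → ℂ, ContinuousOn l K ∧ ∀ z ∈ K, Complex.exp (l z) = g z

namespace HasContinuousLogOn

theorem mono {g : ℂ → ℂ} {K L : Set ℂ} (h : HasContinuousLogOn g L) (hKL : K ⊆ L) :
    HasContinuousLogOn g K := by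
  obtain ⟨l, hl, h⟩ := h
  exact ⟨l, hl.mono hKL, fun z hz => h z (hKL hz)⟩

theorem congr {g g' : ℂ → ℂ} {K : Set ℂ} (h : HasContinuousLogOn g K)
    (hg : ∀ z ∈ K, g z = g' z) : HasContinuousLogOn g' K := by
  obtain ⟨l, hl, h⟩ := h
  exact ⟨l, hl, fun z hz => (h z hz).trans (hg z hz)⟩

theorem mul {g g' : ℂ → ℂ} {K : Set ℂ} (h : HasContinuousLogOn g K)
    (h' : HasContinuousLogOn g' K) : HasContinuousLogOn (fun z => g z * g' z) K := by
  obtain ⟨l, hl, h⟩ := h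
  obtain ⟨l', hl', h'⟩ := h'
  exact ⟨fun z => l z + l' z, hl.add hl', fun z hz => by
    rw [Complex.exp_add, h z hz, h' z hz]⟩

theorem inv {g : ℂ → ℂ} {K : Set ℂ} (h : HasContinuousLogOn g K) :
    HasContinuousLogOn (fun z => (g z)⁻¹) K := by
  obtain ⟨l, hl, h⟩ := h
  exact ⟨fun z => -l z, hl.neg, fun z hz => by rw [Complex.exp_neg, h z hz]⟩

theorem const {c : ℂ} (hc : c ≠ 0) (K : Set ℂ) : HasContinuousLogOn (fun _ => c) K :=
  ⟨fun _ => Complex.log c, continuousOn_const, fun _ _ => Complex.exp_log hc⟩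

/-- A continuous function with values in the disc of radius one around one has a logarithm. -/
theorem of_norm_sub_one_lt {g : ℂ → ℂ} {K : Set ℂ} (hg : ContinuousOn g K)
    (h : ∀ z ∈ K, ‖g z - 1‖ < 1) : HasContinuousLogOn g K := by
  have hs : ∀ z ∈ K, g z ∈ Complex.slitPlane := fun z hz =>
    Complex.ball_one_subset_slitPlane (by simpa [dist_eq_norm] using h z hz)
  exact ⟨fun z => Complex.log (g z), hg.clog hs,
    fun z hz => Complex.exp_log (Complex.slitPlane_ne_zero (hs z hz))⟩

/-- Logarithms on disjoint open sets can be glued. -/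
theorem iUnion_of_isOpen {ι : Type*} {g : ℂ → ℂ} {U : ι → Set ℂ} (hU : ∀ i, IsOpen (U i))
    (hd : Pairwise fun i j => Disjoint (U i) (U j)) (h : ∀ i, HasContinuousLogOn g (U i)) :
    HasContinuousLogOn g (⋃ i, U i) := by
  classical
  choose l hl hexp using h
  have huniq : ∀ {z i j}, z ∈ U i → z ∈ U j → i = j := by
    intro z i j hi hj
    by_contra hne
    exact Set.disjoint_left.1 (hd hne) hi hj
  let L : ℂ → ℂ := fun z => if hz : ∃ i, z ∈ U i then l hz.choose z else 0
  have hL : ∀ i, ∀ z ∈ U i, L z = l i z := by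
    intro i z hz
    have hex : ∃ i, z ∈ U i := ⟨i, hz⟩
    have : hex.choose = i := huniq hex.choose_spec hz
    simp only [L, dif_pos hex, this]
  refine ⟨L, ?_, ?_⟩
  · intro z hz
    obtain ⟨i, hi⟩ := Set.mem_iUnion.1 hz
    have hnh := (hU i).mem_nhds hi
    refine ContinuousAt.continuousWithinAt ?_
    refine ((hl i).continuousAt hnh).congr ?_
    filter_upwards [hnh] with w hw using (hL i w hw).symm
  · intro z hz
    obtain ⟨i, hi⟩ := Set.mem_iUnion.1 hz
    rw [hL i z hi, hexp i z hi]

/-- Logarithms on two disjoint closed sets can be glued. -/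
theorem union_of_isClosed {g : ℂ → ℂ} {K L : Set ℂ} (hK : IsClosed K) (hL : IsClosed L)
    (hd : Disjoint K L) (h : HasContinuousLogOn g K) (h' : HasContinuousLogOn g L) :
    HasContinuousLogOn g (K ∪ L) := by
  classical
  obtain ⟨l, hl, h⟩ := h
  obtain ⟨l', hl', h'⟩ := h'
  have h2 : ∀ z ∈ L, K.piecewise l l' z = l' z := fun z hz =>
    Set.piecewise_eq_of_notMem _ _ _ (Set.disjoint_right.1 hd hz)
  refine ⟨K.piecewise l l', ?_, ?_⟩
  · exact ContinuousOn.union_of_isClosed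
      (hl.congr fun z hz => Set.piecewise_eq_of_mem _ _ _ hz) (hl'.congr h2) hK hL
  · rintro z (hz | hz)
    · rw [Set.piecewise_eq_of_mem _ _ _ hz, h z hz]
    · rw [h2 z hz, h' z hz]

/-- For `w` outside a disc containing `K`, the function `z - w` has a logarithm on `K`. -/
theorem sub_of_subset_closedBall {K : Set ℂ} {R : ℝ} (hK : K ⊆ Metric.closedBall 0 R) {w : ℂ}
    (hw : R < ‖w‖) : HasContinuousLogOn (fun z => z - w) K := by
  rcases K.eq_empty_or_nonempty with rfl | ⟨z₀, hz₀⟩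
  · exact ⟨0, by simp, by simp⟩
  have hw0 : w ≠ 0 := by
    rintro rfl
    have := hK hz₀
    simp only [mem_closedBall_zero_iff, norm_zero] at this hw
    linarith [norm_nonneg z₀]
  have h1 : HasContinuousLogOn (fun z => 1 - z / w) K := by
    refine of_norm_sub_one_lt (by fun_prop) fun z hz => ?_
    have := mem_closedBall_zero_iff.1 (hK hz)
    rw [sub_sub_cancel_left, norm_neg, norm_div, div_lt_one (norm_pos_iff.2 hw0)]
    linarith
  refine ((const (neg_ne_zero.2 hw0) K).mul h1).congr fun z _ => ?_
  field_simp
  ring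

end HasContinuousLogOn

/-- No continuous function on the plane is a logarithm of `z - w` off a disc. -/
theorem not_exists_exp_eq_sub_of_large (w : ℂ) (R : ℝ) (G : C(ℂ, ℂ))
    (h : ∀ z, R ≤ ‖z‖ → Complex.exp (G z) = z - w) : False := by
  set r : ℝ := |R| + ‖w‖ + 1 with hr
  have hrpos : 0 < r := by positivity
  -- Since `exp ∘ H = 1`, `H` takes values in a discrete fibre and is constant; but the circle
  -- closes up, so `H` changes by `-2πi` over one turn.
  let H : ℝ → ℂ := fun t => G (circleMap w r t) - Complex.log r - t * Complex.I
  have hHc : Continuous H := by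
    have := continuous_circleMap w r
    fun_prop
  have hH : ∀ t, Complex.exp (H t) = 1 := by
    intro t
    have hn : R ≤ ‖circleMap w r t‖ := by
      have h1 : ‖circleMap w r t - w‖ = r := by
        simp [circleMap, abs_of_pos hrpos]
      have h2 := norm_sub_le (circleMap w r t) w
      rw [h1] at h2
      linarith [le_abs_self R]
    rw [Complex.exp_sub, Complex.exp_sub, h _ hn, Complex.exp_log (by exact_mod_cast hrpos.ne')]
    simp only [circleMap, add_sub_cancel_left]
    have : (r : ℂ) ≠ 0 := by exact_mod_cast hrpos.ne'
    field_simp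
  have hconst : ∀ s t, H s = H t := by
    have hcov := Complex.isCoveringMap_exp
    refine fun s t => hcov.const_of_comp hHc (fun a a' => ?_) s t
    exact Subtype.ext ((hH a).trans (hH a').symm)
  have := hconst 0 (2 * Real.pi)
  simp only [H, circleMap, Complex.ofReal_zero, zero_mul, Complex.exp_zero] at this
  push_cast at this
  rw [Complex.exp_two_pi_mul_I] at this
  have h2 : (2 * Real.pi : ℂ) * Complex.I = 0 := by linear_combination this
  simp [Real.pi_ne_zero] at h2

/-- Eilenberg's criterion: if `z - w` has a continuous logarithm on the compact set `K`, then `w`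
lies in an unbounded component of the complement of `K`. -/
theorem not_isBounded_connectedComponentIn_of_hasContinuousLogOn {K : Set ℂ} (hK : IsCompact K)
    {w : ℂ} (hw : w ∉ K) (hlog : HasContinuousLogOn (fun z => z - w) K) :
    ¬ Bornology.IsBounded (connectedComponentIn Kᶜ w) := by
  classical
  intro hb
  set Ω := connectedComponentIn Kᶜ w with hΩ
  have hwΩ : w ∈ Ω := mem_connectedComponentIn hw
  have hΩo : IsOpen Ω := hK.isClosed.isOpen_compl.connectedComponentIn
  obtain ⟨l, hl, hexp⟩ := hlog
  obtain ⟨L, hL⟩ := ContinuousMap.exists_restrict_eq hK.isClosed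
    ⟨K.domRestrict l, continuousOn_iff_continuous_domRestrict.1 hl⟩
  have hLK : ∀ z ∈ K, L z = l z := fun z hz => by
    have := congrArg (fun g => g ⟨z, hz⟩) hL
    exact this
  have hfr : ∀ z ∈ frontier Ω, z ∈ K := by
    intro z hz
    by_contra hzK
    have hcl : z ∈ closure Ω := hz.1
    have hzn : z ∉ Ω := by
      rw [hΩo.frontier_eq] at hz
      exact hz.2
    have hopen : IsOpen (connectedComponentIn Kᶜ z) := hK.isClosed.isOpen_compl.connectedComponentIn
    obtain ⟨y, hy1, hy2⟩ := mem_closure_iff.1 hcl _ hopen (mem_connectedComponentIn hzK)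
    have h1 := connectedComponentIn_eq hy1
    have h2 := connectedComponentIn_eq hy2
    exact hzn (by rw [hΩ, h2, ← h1]; exact mem_connectedComponentIn hzK)
  -- `L` is a Tietze extension of the logarithm. Replacing `z - w` by `exp ∘ L` on `Ω` removes its
  -- only zero, and the two pieces agree on the frontier. The zero-free `F` lifts through `exp` on
  -- the whole plane, and if `Ω` is bounded the lift is a logarithm of `z - w` near infinity.
  let F : ℂ → ℂ := Ω.piecewise (fun z => Complex.exp (L z)) (fun z => z - w)
  have hFc : Continuous F := by
    refine Continuous.piecewise (fun z hz => ?_) (by fun_prop) (by fun_prop)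
    rw [hLK z (hfr z hz), hexp z (hfr z hz)]
  have hF0 : ∀ z, F z ≠ 0 := by
    intro z
    by_cases hz : z ∈ Ω
    · simp only [F, Set.piecewise_eq_of_mem _ _ _ hz]
      exact Complex.exp_ne_zero _
    · simp only [F, Set.piecewise_eq_of_notMem _ _ _ hz]
      exact sub_ne_zero.2 fun h => hz (h ▸ hwΩ)
  obtain ⟨G, ⟨-, hG⟩, -⟩ := Complex.isCoveringMapOn_exp.existsUnique_continuousMap_lifts
    (⟨F, hFc⟩ : C(ℂ, ℂ)) (a₀ := 0) (e₀ := Complex.log (F 0)) (Complex.exp_log (hF0 0))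
    (fun z => hF0 z)
  obtain ⟨R, hR⟩ := hb.subset_closedBall 0
  refine not_exists_exp_eq_sub_of_large w (R + 1) G fun z hz => ?_
  have h1 : Complex.exp (G z) = F z := congrFun hG z
  have hz' : z ∉ Ω := fun h => by
    have := mem_closedBall_zero_iff.1 (hR h)
    linarith
  rw [h1]
  simp only [F, Set.piecewise_eq_of_notMem _ _ _ hz']

/-! ### Filling the holes of a compact set. -/

/-- The union of a plane set with the bounded components of its complement. -/
def planeHull (K : Set ℂ) : Set ℂ :=
  {w | Bornology.IsBounded (connectedComponentIn Kᶜ w)}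

theorem mem_planeHull {K : Set ℂ} {w : ℂ} :
    w ∈ planeHull K ↔ Bornology.IsBounded (connectedComponentIn Kᶜ w) := Iff.rfl

theorem subset_planeHull (K : Set ℂ) : K ⊆ planeHull K := fun w hw => by
  rw [mem_planeHull, connectedComponentIn_eq_empty (by simpa using hw)]
  exact Bornology.isBounded_empty

theorem planeHull_subset_closedBall {K : Set ℂ} {R : ℝ} (hK : K ⊆ Metric.closedBall 0 R) :
    planeHull K ⊆ Metric.closedBall 0 R := by
  intro w hw
  by_contra hwR
  rw [mem_closedBall_zero_iff, not_le] at hwR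
  by_cases hw0 : w = 0
  · subst hw0
    have hKe : K = ∅ := by
      rw [Set.eq_empty_iff_forall_notMem]
      intro z hz
      have := mem_closedBall_zero_iff.1 (hK hz)
      simp only [norm_zero] at hwR
      linarith [norm_nonneg z]
    rw [mem_planeHull, hKe, Set.compl_empty, connectedComponentIn_univ,
      PreconnectedSpace.connectedComponent_eq_univ] at hw
    exact NormedSpace.unbounded_univ ℝ ℂ hw
  -- The outward ray from `w` avoids `K`, so the component of `w` is unbounded.
  have hray : (fun t : ℝ => (t : ℂ) * w) '' Set.Ici 1 ⊆ connectedComponentIn Kᶜ w := by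
    refine IsPreconnected.subset_connectedComponentIn ?_ ⟨1, by simp, by simp⟩ ?_
    · exact isPreconnected_Ici.image _ (by fun_prop)
    · rintro _ ⟨t, ht, rfl⟩ htK
      have ht1 : (1 : ℝ) ≤ t := ht
      have := mem_closedBall_zero_iff.1 (hK htK)
      rw [norm_mul, Complex.norm_real, Real.norm_eq_abs, abs_of_pos (by linarith)] at this
      nlinarith [norm_nonneg w]
  obtain ⟨C, hC⟩ := ((mem_planeHull.1 hw).subset hray).subset_closedBall 0
  have hwpos : 0 < ‖w‖ := norm_pos_iff.2 hw0
  have := mem_closedBall_zero_iff.1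
    (hC ⟨max 1 ((|C| + 1) / ‖w‖), Set.mem_Ici.2 (le_max_left _ _), rfl⟩)
  rw [norm_mul, Complex.norm_real, Real.norm_eq_abs,
    abs_of_pos (lt_of_lt_of_le one_pos (le_max_left _ _))] at this
  have h2 : (|C| + 1) / ‖w‖ * ‖w‖ ≤ max 1 ((|C| + 1) / ‖w‖) * ‖w‖ :=
    mul_le_mul_of_nonneg_right (le_max_right _ _) hwpos.le
  rw [div_mul_cancel₀ _ hwpos.ne'] at h2
  linarith [le_abs_self C]

theorem connectedComponentIn_subset_compl_planeHull {K : Set ℂ} {w : ℂ} (hw : w ∉ planeHull K) :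
    connectedComponentIn Kᶜ w ⊆ (planeHull K)ᶜ := fun z hz hz' => hw <| by
  rw [mem_planeHull, connectedComponentIn_eq hz]
  exact hz'

theorem isCompact_planeHull {K : Set ℂ} (hK : IsCompact K) : IsCompact (planeHull K) := by
  obtain ⟨R, hR⟩ := hK.isBounded.subset_closedBall 0
  refine Metric.isCompact_of_isClosed_isBounded ?_
    (Metric.isBounded_closedBall.subset (planeHull_subset_closedBall hR))
  rw [← isOpen_compl_iff, isOpen_iff_mem_nhds]
  intro w hw
  have hwK : w ∈ Kᶜ := fun h => hw (subset_planeHull K h)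
  exact mem_of_superset
    (hK.isClosed.isOpen_compl.connectedComponentIn.mem_nhds (mem_connectedComponentIn hwK))
    (connectedComponentIn_subset_compl_planeHull hw)

/-- Off the hull of a compact set, `z - w` has a continuous logarithm on the hull. -/
theorem hasContinuousLogOn_planeHull {K : Set ℂ} (hK : IsCompact K) {w : ℂ}
    (hw : w ∉ planeHull K) : HasContinuousLogOn (fun z => z - w) (planeHull K) := by
  set E := planeHull K with hE
  have hEc : IsCompact E := isCompact_planeHull hK
  set Ω := connectedComponentIn Kᶜ w with hΩ
  have hwK : w ∈ Kᶜ := fun h => hw (subset_planeHull K h)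
  have hΩE : Ω ⊆ Eᶜ := connectedComponentIn_subset_compl_planeHull hw
  obtain ⟨R, hR⟩ := hEc.isBounded.subset_closedBall 0
  obtain ⟨a, haΩ, haR⟩ : ∃ a ∈ Ω, R < ‖a‖ := by
    by_contra! h
    exact hw (Metric.isBounded_closedBall.subset fun z hz => mem_closedBall_zero_iff.2 (h z hz))
  have hne : ∀ {x z}, x ∈ Ω → z ∈ E → z - x ≠ 0 := fun hx hz h =>
    hΩE hx (sub_eq_zero.1 h ▸ hz)
  -- For nearby `x, y` in `Ω` the quotient `(z - x) / (z - y)` is close to `1` on `E`. Connectedness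
  -- of `Ω` carries the logarithm from `w` to the point `a` outside a disc containing `E`, where `z
  -- - a` has a logarithm.
  have key : HasContinuousLogOn (fun z => (z - w) / (z - a)) E := by
    refine isPreconnected_connectedComponentIn.induction₂ (s := Ω)
      (P := fun x y => HasContinuousLogOn (fun z => (z - x) / (z - y)) E)
      ?_ ?_ ?_ (mem_connectedComponentIn hwK) haΩ
    · intro x hx
      obtain ⟨ε, hε, hball⟩ := Metric.mem_nhds_iff.1 (hEc.isClosed.isOpen_compl.mem_nhds (hΩE hx))
      filter_upwards [nhdsWithin_le_nhds (Metric.ball_mem_nhds x (half_pos hε)),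
        self_mem_nhdsWithin] with y hy hyΩ
      refine HasContinuousLogOn.of_norm_sub_one_lt
        (ContinuousOn.div (by fun_prop) (by fun_prop) fun z hz => hne hyΩ hz) fun z hz => ?_
      have h0 := hne hyΩ hz
      have : (z - x) / (z - y) - 1 = (y - x) / (z - y) := by
        field_simp
        ring
      rw [this, norm_div, div_lt_one (norm_pos_iff.2 h0)]
      have h1 : ε ≤ ‖z - x‖ := by
        by_contra! hlt
        exact hball (mem_ball_iff_norm.2 hlt) hz
      have h2 : ‖y - x‖ < ε / 2 := mem_ball_iff_norm.1 hy
      have h3 : ‖z - x‖ ≤ ‖z - y‖ + ‖y - x‖ := by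
        simpa using norm_add_le (z - y) (y - x)
      linarith
    · intro x y t hx hy ht h1 h2
      refine (h1.mul h2).congr fun z hz => ?_
      have := hne hy hz
      have := hne ht hz
      field_simp
    · intro x y hx hy h
      refine h.inv.congr fun z hz => ?_
      rw [inv_div]
  refine (key.mul (HasContinuousLogOn.sub_of_subset_closedBall hR haR)).congr fun z hz => ?_
  have := hne haΩ hz
  field_simp

/-! ### The Cauchy–Pompeiu formula and Runge's theorem. -/

open MeasureTheory Complex in
/-- The Cauchy–Pompeiu formula for compactly supported functions of class `C¹`. -/
theorem cauchyPompeiu_of_hasCompactSupport {u : ℂ → ℂ} (hu : ContDiff ℝ 1 u)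
    (hs : HasCompactSupport u) (z : ℂ) :
    ∫ w, (fderiv ℝ u w 1 + I * fderiv ℝ u w I) * (z - w)⁻¹ = 2 * Real.pi * u z := by
  have hdu : Continuous (fderiv ℝ u) := hu.continuous_fderiv one_ne_zero
  have hdiff : Differentiable ℝ u := hu.differentiable one_ne_zero
  obtain ⟨R, hR⟩ : ∃ R : ℝ, ∀ w, R ≤ ‖w - z‖ → u w = 0 ∧ fderiv ℝ u w = 0 := by
    obtain ⟨R, hR⟩ := hs.isCompact.isBounded.subset_closedBall z
    refine ⟨|R| + 1, fun w hw => ?_⟩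
    have hw' : w ∉ tsupport u := fun h => by
      have := mem_closedBall_iff_norm.1 (hR h)
      linarith [le_abs_self R]
    refine ⟨image_eq_zero_of_notMem_tsupport hw', ?_⟩
    exact image_eq_zero_of_notMem_tsupport fun h => hw' (tsupport_fderiv_subset ℝ h)
  let e : ℝ → ℂ := fun θ => Real.cos θ + Real.sin θ * I
  have hec : Continuous e := by fun_prop
  have hen : ∀ θ, ‖e θ‖ = 1 := fun θ => by
    simp only [e]
    push_cast
    exact norm_cos_add_sin_mul_I θ
  have hinv : ∀ θ, (e θ)⁻¹ = Real.cos θ - Real.sin θ * I := fun θ => by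
    refine inv_eq_of_mul_eq_one_right ?_
    simp only [e]
    have h1 : (Real.cos θ : ℂ) ^ 2 + (Real.sin θ : ℂ) ^ 2 = 1 := by
      exact_mod_cast Real.cos_sq_add_sin_sq θ
    linear_combination h1 - (Real.sin θ : ℂ) ^ 2 * I_sq
  -- In polar coordinates about `z`, `g₁ = ∂u/∂r` and `r * g₂ = ∂u/∂θ`. The Jacobian `r` cancels the
  -- pole, leaving the integrand `-(g₁ + i g₂)`: `g₁` integrates radially to `-u z`, and `g₂` to
  -- zero over a full turn.
  let g₁ : ℝ × ℝ → ℂ := fun p => fderiv ℝ u (z + p.1 * e p.2) (e p.2)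
  let g₂ : ℝ × ℝ → ℂ := fun p => fderiv ℝ u (z + p.1 * e p.2) (I * e p.2)
  have hg₁c : Continuous g₁ := by
    have h1 : Continuous fun p : ℝ × ℝ => fderiv ℝ u (z + p.1 * e p.2) := hdu.comp (by fun_prop)
    exact h1.clm_apply (by fun_prop)
  have hg₂c : Continuous g₂ := by
    have h1 : Continuous fun p : ℝ × ℝ => fderiv ℝ u (z + p.1 * e p.2) := hdu.comp (by fun_prop)
    exact h1.clm_apply (by fun_prop)
  have hfar : ∀ p : ℝ × ℝ, R ≤ p.1 → u (z + p.1 * e p.2) = 0 ∧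
      fderiv ℝ u (z + p.1 * e p.2) = 0 := fun p hp => by
    refine hR _ ?_
    rw [add_sub_cancel_left, norm_mul, hen, mul_one, norm_real]
    exact hp.trans (le_abs_self _)
  set S : Set (ℝ × ℝ) := Set.Ioi (0 : ℝ) ×ˢ Set.Ioo (-Real.pi) Real.pi with hS
  have hint : ∀ g : ℝ × ℝ → ℂ, Continuous g → (∀ p : ℝ × ℝ, R ≤ p.1 → g p = 0) →
      IntegrableOn g S (volume.prod volume) := by
    intro g hg h0
    have hcomp : IntegrableOn g (Set.Icc (0 : ℝ) R ×ˢ Set.Icc (-Real.pi) Real.pi)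
        (volume.prod volume) :=
      hg.continuousOn.integrableOn_compact (isCompact_Icc.prod isCompact_Icc)
    refine hcomp.of_forall_sdiff_eq_zero
      (measurableSet_Ioi.prod measurableSet_Ioo) ?_
    rintro p ⟨⟨hp1, hp2⟩, hp3⟩
    refine h0 p ?_
    by_contra! hlt
    exact hp3 ⟨⟨le_of_lt hp1, hlt.le⟩, ⟨hp2.1.le, hp2.2.le⟩⟩
  have hi₁ := hint g₁ hg₁c fun p hp => by simp [g₁, (hfar p hp).2]
  have hi₂ := hint g₂ hg₂c fun p hp => by simp [g₂, (hfar p hp).2]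
  have hder₁ : ∀ θ r : ℝ, HasDerivAt (fun r : ℝ => u (z + r * e θ)) (g₁ (r, θ)) r := by
    intro θ r
    have h1 : HasDerivAt (fun r : ℝ => z + r * e θ) (e θ) r := by
      simpa using ((ofRealCLM.hasDerivAt (x := r)).mul_const (e θ)).const_add z
    exact (hdiff _).hasFDerivAt.comp_hasDerivAt r h1
  have hder₂ : ∀ r θ : ℝ, HasDerivAt (fun θ : ℝ => u (z + r * e θ)) (r * g₂ (r, θ)) θ := by
    intro r θ
    have h0 : HasDerivAt e (I * e θ) θ := by
      have h1 : HasDerivAt e (((-Real.sin θ : ℝ) : ℂ) + ((Real.cos θ : ℝ) : ℂ) * I) θ :=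
        ((Real.hasDerivAt_cos θ).ofReal_comp).add
          (((Real.hasDerivAt_sin θ).ofReal_comp).mul_const I)
      convert! h1 using 1
      simp only [e]
      push_cast
      linear_combination (Complex.sin θ) * I_sq
    have h1 : HasDerivAt (fun θ : ℝ => z + r * e θ) (r * (I * e θ)) θ :=
      (h0.const_mul (r : ℂ)).const_add z
    have h2 := (hdiff _).hasFDerivAt.comp_hasDerivAt θ h1
    have h3 : fderiv ℝ u (z + r * e θ) (r * (I * e θ)) = r * g₂ (r, θ) := by
      rw [← real_smul (x := r) (z := I * e θ), map_smul, real_smul]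
    rw [h3] at h2
    exact h2
  have hI₁ : ∫ p in S, g₁ p ∂(volume.prod volume) = -(2 * Real.pi * u z) := by
    rw [hS, ← Measure.prod_restrict, integral_prod_symm]
    · have hinner : ∀ θ : ℝ, ∫ r in Set.Ioi (0 : ℝ), g₁ (r, θ) = -u z := by
        intro θ
        have hic : Continuous fun r : ℝ => g₁ (r, θ) := by fun_prop
        have hio : IntegrableOn (fun r : ℝ => g₁ (r, θ)) (Set.Ioi 0) := by
          have hcomp : IntegrableOn (fun r : ℝ => g₁ (r, θ)) (Set.Icc (0 : ℝ) R) :=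
            hic.continuousOn.integrableOn_compact isCompact_Icc
          refine hcomp.of_forall_sdiff_eq_zero measurableSet_Ioi ?_
          rintro r ⟨hr1, hr2⟩
          have : R ≤ r := by
            by_contra! hlt
            exact hr2 ⟨le_of_lt hr1, hlt.le⟩
          simp [g₁, (hfar (r, θ) this).2]
        rw [integral_Ioi_of_hasDerivAt_of_tendsto
          (f := fun r : ℝ => u (z + r * e θ)) (m := 0) (hder₁ θ 0).continuousAt.continuousWithinAt
          (fun r _ => hder₁ θ r) hio ?_]
        · simp
        · refine tendsto_const_nhds.congr' ?_
          filter_upwards [eventually_ge_atTop R] with r hr using ((hfar (r, θ) hr).1).symm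
      simp only [hinner, setIntegral_const, measureReal_def, Real.volume_Ioo]
      rw [ENNReal.toReal_ofReal (by linarith [Real.pi_pos]), real_smul]
      push_cast
      ring
    · rw [Measure.prod_restrict]
      exact hi₁
  have hI₂ : ∫ p in S, g₂ p ∂(volume.prod volume) = 0 := by
    rw [hS, setIntegral_prod _ hi₂]
    refine setIntegral_eq_zero_of_forall_eq_zero fun r hr => ?_
    have hr0 : (r : ℂ) ≠ 0 := by exact_mod_cast (ne_of_gt hr : r ≠ 0)
    have hic : Continuous fun θ : ℝ => (r : ℂ) * g₂ (r, θ) := by fun_prop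
    have h1 := intervalIntegral.integral_eq_sub_of_hasDerivAt
      (fun θ _ => hder₂ r θ) (hic.intervalIntegrable (-Real.pi) Real.pi)
    have h2 : u (z + r * e Real.pi) - u (z + r * e (-Real.pi)) = 0 := by simp [e]
    rw [h2, intervalIntegral.integral_const_mul, mul_eq_zero, or_iff_right hr0,
      intervalIntegral.integral_of_le (by linarith [Real.pi_pos]),
      integral_Ioc_eq_integral_Ioo] at h1
    exact h1
  calc ∫ w, (fderiv ℝ u w 1 + I * fderiv ℝ u w I) * (z - w)⁻¹
      = ∫ w, (fderiv ℝ u (z + w) 1 + I * fderiv ℝ u (z + w) I) * (z - (z + w))⁻¹ :=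
        (integral_add_left_eq_self
          (fun w => (fderiv ℝ u w 1 + I * fderiv ℝ u w I) * (z - w)⁻¹) z).symm
    _ = ∫ p in S, -(g₁ p + I * g₂ p) ∂(volume.prod volume) := by
        rw [← Complex.integral_comp_polarCoord_symm, polarCoord_target]
        refine setIntegral_congr_fun (measurableSet_Ioi.prod measurableSet_Ioo) ?_
        rintro ⟨r, θ⟩ ⟨hr, -⟩
        have hr0 : (r : ℂ) ≠ 0 := by exact_mod_cast (ne_of_gt hr : r ≠ 0)
        simp only [Complex.polarCoord_symm_apply, g₁, g₂, real_smul]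
        change (r : ℂ) * ((fderiv ℝ u (z + r * e θ) 1 + I * fderiv ℝ u (z + r * e θ) I) *
          (z - (z + r * e θ))⁻¹) = _
        have hlin : ∀ a b : ℝ, fderiv ℝ u (z + r * e θ) (a + b * I) =
            a * fderiv ℝ u (z + r * e θ) 1 + b * fderiv ℝ u (z + r * e θ) I := by
          intro a b
          have : (a + b * I : ℂ) = a • (1 : ℂ) + b • I := by simp
          rw [this, map_add, map_smul, map_smul, real_smul, real_smul]
        have hIe : I * e θ = ((-Real.sin θ : ℝ) : ℂ) + (Real.cos θ : ℝ) * I := by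
          simp only [e]
          push_cast
          linear_combination (Complex.sin θ) * I_sq
        rw [hIe, hlin, hlin, sub_add_cancel_left,
          inv_neg, mul_inv, hinv]
        field_simp
        push_cast
        linear_combination ((Complex.sin θ) * fderiv ℝ u (z + r * e θ) I) * I_sq
    _ = 2 * Real.pi * u z := by
        rw [integral_neg, integral_add hi₁ (hi₂.const_mul I), integral_const_mul, hI₁, hI₂]
        ring

/-- Runge's theorem for compact sets `E` such that each `z - w`, `w ∉ E`, has a continuous logarithm
on `E`: functions holomorphic near `E` are uniform limits of polynomials on `E`. -/
theorem exists_polynomial_approx_of_hasContinuousLogOn {E V : Set ℂ} (hE : IsCompact E)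
    (hlog : ∀ w ∉ E, HasContinuousLogOn (fun z => z - w) E) (hV : IsOpen V) (hEV : E ⊆ V)
    {φ : ℂ → ℂ} (hφ : DifferentiableOn ℂ φ V) {ε : ℝ} (hε : 0 < ε) :
    ∃ p : Polynomial ℂ, ∀ z ∈ E, ‖φ z - p.eval z‖ < ε := by
  have : CompactSpace E := isCompact_iff_compactSpace.1 hE
  -- a compactly supported extension of `φ`, holomorphic near `E`
  obtain ⟨u, W, hu, hus, hW, hEW, huφ, hD0⟩ : ∃ (u : ℂ → ℂ) (W : Set ℂ), ContDiff ℝ 1 u ∧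
      HasCompactSupport u ∧ IsOpen W ∧ E ⊆ W ∧ (∀ z ∈ W, u z = φ z) ∧
      ∀ z ∈ W, fderiv ℝ u z 1 + Complex.I * fderiv ℝ u z Complex.I = 0 := by
    obtain ⟨t, ht, hEt, htV⟩ := exists_compact_between hE hV hEV
    obtain ⟨χ, h1, h0, -⟩ := exists_contMDiffMap_one_nhds_of_subset_interior (n := 1)
      (modelWithCornersSelf ℝ ℂ) hE.isClosed hEt
    have hχ : ContDiff ℝ 1 χ := χ.contMDiff.contDiff
    obtain ⟨W, hW, hEW, hW1⟩ := eventually_nhdsSet_iff_exists.1 h1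
    have huW : ∀ z ∈ W ∩ V, χ z • φ z = φ z := fun z hz => by rw [hW1 z hz.1, one_smul]
    refine ⟨fun z => χ z • φ z, W ∩ V, ?_, ?_, hW.inter hV, Set.subset_inter hEW hEV, huW, ?_⟩
    · rw [contDiff_iff_contDiffAt]
      intro z
      by_cases hz : z ∈ V
      · exact hχ.contDiffAt.smul
          ((hφ.analyticAt (hV.mem_nhds hz)).contDiffAt.restrict_scalars ℝ)
      · refine contDiffAt_const (c := (0 : ℂ)) |>.congr_of_eventuallyEq ?_
        filter_upwards [ht.isClosed.isOpen_compl.mem_nhds fun h => hz (htV h)] with w hw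
        rw [h0 w hw, zero_smul]
    · refine HasCompactSupport.intro ht fun z hz => ?_
      simp only [h0 z hz, zero_smul]
    · intro z hz
      have heq : (fun z => χ z • φ z) =ᶠ[𝓝 z] φ := by
        filter_upwards [(hW.inter hV).mem_nhds hz] with w hw using huW w hw
      have hd := (hφ.differentiableAt (hV.mem_nhds hz.2)).hasFDerivAt
      rw [heq.fderiv_eq, (hd.restrictScalars ℝ).fderiv]
      have : fderiv ℂ φ z Complex.I = Complex.I * fderiv ℂ φ z 1 := by
        rw [← smul_eq_mul, ← map_smul, smul_eq_mul, mul_one]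
      simp only [ContinuousLinearMap.coe_restrictScalars', this]
      linear_combination fderiv ℂ φ z 1 * Complex.I_sq
  set D : ℂ → ℂ := fun w => fderiv ℝ u w 1 + Complex.I * fderiv ℝ u w Complex.I with hDdef
  have hDc : Continuous D := by
    have := hu.continuous_fderiv one_ne_zero
    fun_prop
  have hDs : HasCompactSupport D := by
    refine HasCompactSupport.intro hus.isCompact fun w hw => ?_
    have : fderiv ℝ u w = 0 :=
      image_eq_zero_of_notMem_tsupport fun h => hw (tsupport_fderiv_subset ℝ h)
    simp [hDdef, this]
  -- the closure of the polynomials in `C(E, ℂ)`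
  let X : C(E, ℂ) := ⟨fun z => z, continuous_subtype_val⟩
  let P : Subalgebra ℂ C(E, ℂ) := (polynomialFunctions E).topologicalClosure
  have hPc : IsClosed (P : Set C(E, ℂ)) := Subalgebra.isClosed_topologicalClosure _
  have : CompleteSpace P := hPc.completeSpace_coe
  have hXP : X ∈ P := Subalgebra.le_topologicalClosure _ ⟨Polynomial.X, trivial, by
    ext z
    simp [X]⟩
  -- The Cauchy kernel `z ↦ 1 / (z - w)` as an element of `C(E, ℂ)`. For `w ∈ E` it takes the
  -- default value `0`, which is harmless because `D` vanishes there.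
  let k : ℂ → C(E, ℂ) := fun w => Ring.inverse (X - algebraMap ℂ _ w)
  have hunit : ∀ w ∉ E, IsUnit (X - algebraMap ℂ C(E, ℂ) w) := by
    intro w hw
    rw [ContinuousMap.isUnit_iff_forall_ne_zero]
    intro z hz
    have hz' : (z : ℂ) - w = 0 := by simpa [X] using hz
    exact hw (sub_eq_zero.1 hz' ▸ z.2)
  have hkz : ∀ w ∉ E, ∀ z : E, k w z = ((z : ℂ) - w)⁻¹ := by
    intro w hw z
    have h1 : (k w * (X - algebraMap ℂ C(E, ℂ) w)) z = 1 := by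
      rw [Ring.inverse_mul_cancel _ (hunit w hw)]
      rfl
    refine eq_inv_of_mul_eq_one_left ?_
    simpa [X] using h1
  -- The spectrum of `X` in `C(E, ℂ)` is `E`. Passing to the closed subalgebra `P` can only add
  -- points in bounded components of the complement, and Eilenberg's criterion says that there are
  -- none.
  have hkP : ∀ w ∉ E, k w ∈ P := by
    intro w hw
    have hspec : spectrum ℂ X = E := by
      rw [ContinuousMap.spectrum_eq_range]
      exact Subtype.range_coe
    have hns : w ∉ spectrum ℂ (⟨X, hXP⟩ : P) := fun h => by
      have := Subalgebra.spectrum_isBounded_connectedComponentIn P ⟨X, hXP⟩ h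
      rw [hspec] at this
      exact not_isBounded_connectedComponentIn_of_hasContinuousLogOn hE hw (hlog w hw) this
    rw [spectrum.notMem_iff] at hns
    obtain ⟨y, hy⟩ := hns.exists_right_inv
    have hy' : (algebraMap ℂ C(E, ℂ) w - X) * (y : C(E, ℂ)) = 1 := congrArg Subtype.val hy
    have : k w = -(y : C(E, ℂ)) := by
      have h1 : (X - algebraMap ℂ C(E, ℂ) w) * -(y : C(E, ℂ)) = 1 := by
        rw [← hy']
        ring
      calc k w = k w * ((X - algebraMap ℂ C(E, ℂ) w) * -(y : C(E, ℂ))) := by rw [h1, mul_one]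
        _ = -(y : C(E, ℂ)) := by
          rw [← mul_assoc, Ring.inverse_mul_cancel _ (hunit w hw), one_mul]
    rw [this]
    exact P.neg_mem y.2
  have hDE : ∀ w ∈ E, D w = 0 := fun w hw => hD0 w (hEW hw)
  let Ψ : ℂ → P := fun w => ⟨D w • k w, by
    by_cases hw : w ∈ E
    · rw [hDE w hw, zero_smul]
      exact P.zero_mem
    · exact P.smul_mem (hkP w hw) _⟩
  have hΨc : Continuous Ψ := by
    refine Continuous.subtype_mk (continuous_iff_continuousAt.2 fun w => ?_) _
    by_cases hw : w ∈ E
    · refine (continuousAt_const (y := (0 : C(E, ℂ)))).congr ?_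
      filter_upwards [hW.mem_nhds (hEW hw)] with v hv
      rw [show D v = 0 from hD0 v hv, zero_smul]
    · refine hDc.continuousAt.smul ?_
      obtain ⟨a, ha⟩ := hunit w hw
      have h1 : ContinuousAt Ring.inverse (X - algebraMap ℂ C(E, ℂ) w) :=
        ha ▸ NormedRing.inverse_continuousAt a
      exact ContinuousAt.comp (f := fun w => X - algebraMap ℂ C(E, ℂ) w) h1 (by fun_prop)
  have hΨs : HasCompactSupport Ψ := by
    refine HasCompactSupport.intro hDs.isCompact fun w hw => Subtype.ext ?_
    simp only [Ψ, image_eq_zero_of_notMem_tsupport hw, zero_smul]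
    rfl
  have hΨi : MeasureTheory.Integrable Ψ := hΨc.integrable_of_hasCompactSupport hΨs
  -- The integral of `Ψ` is taken in the Banach space `P`, so it is automatically a uniform limit of
  -- polynomials. Point evaluations commute with it, and Cauchy–Pompeiu identifies it.
  have hval : ∀ z : E, ((∫ w, Ψ w : P) : C(E, ℂ)) z = 2 * Real.pi * φ z := by
    intro z
    let T : P →L[ℂ] ℂ := (ContinuousMap.evalCLM ℂ z).comp P.toSubmodule.subtypeL
    have h1 := T.integral_comp_comm hΨi
    have h2 : ∀ w, T (Ψ w) = D w * ((z : ℂ) - w)⁻¹ := by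
      intro w
      change D w * k w z = _
      by_cases hw : w ∈ E
      · rw [hDE w hw, zero_mul, zero_mul]
      · rw [hkz w hw z]
    simp only [h2] at h1
    rw [cauchyPompeiu_of_hasCompactSupport hu hus, huφ z (hEW z.2)] at h1
    exact h1.symm
  have hπ : (2 * Real.pi : ℂ) ≠ 0 := by simp [Real.pi_ne_zero]
  let G : P := (2 * Real.pi : ℂ)⁻¹ • ∫ w, Ψ w
  have hG : ∀ z : E, (G : C(E, ℂ)) z = φ z := by
    intro z
    change (2 * Real.pi : ℂ)⁻¹ * ((∫ w, Ψ w : P) : C(E, ℂ)) z = φ z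
    rw [hval, inv_mul_cancel_left₀ hπ]
  obtain ⟨q, hq, hGq⟩ := Metric.mem_closure_iff.1 G.2 ε hε
  obtain ⟨p, -, rfl⟩ := hq
  refine ⟨p, fun z hz => ?_⟩
  have := (ContinuousMap.dist_lt_iff hε).1 hGq ⟨z, hz⟩
  rw [hG, dist_eq_norm] at this
  simpa using this

/-! ### Schwarz–Pick and hyperbolic distance. -/

open UpperHalfPlane ComplexConjugate in
/-- The Schwarz–Pick lemma for the upper half-plane, with the rigidity of the equality case. -/
theorem schwarzPick_upperHalfPlane {T : ℂ → ℂ} (hT : DifferentiableOn ℂ T {a | 0 < a.im})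
    (hmaps : ∀ a : ℍ, 0 < (T a).im) (a b : ℍ) :
    dist (⟨T a, hmaps a⟩ : ℍ) ⟨T b, hmaps b⟩ ≤ dist a b ∧
      (a ≠ b → dist (⟨T a, hmaps a⟩ : ℍ) ⟨T b, hmaps b⟩ = dist a b →
        Set.InjOn T {a | 0 < a.im}) := by
  -- `q a` is the Cayley map of the half-plane onto the unit disc sending `a` to `0`; `c` below
  -- inverts it.
  let q : ℂ → ℂ → ℂ := fun a z => (z - a) / (z - conj a)
  have hden : ∀ {a z : ℂ}, 0 < a.im → 0 < z.im → z - conj a ≠ 0 := by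
    intro a z ha hz h
    have := congrArg Complex.im h
    simp at this
    linarith
  have hqdist : ∀ a z : ℍ, ‖q a z‖ = Real.tanh (dist a z / 2) := by
    intro a z
    rw [dist_comm a z, tanh_half_dist, dist_eq_norm, dist_eq_norm, ← norm_div]
  have hqlt : ∀ {a z : ℂ}, 0 < a.im → 0 < z.im → ‖q a z‖ < 1 := by
    intro a z ha hz
    have := hqdist ⟨a, ha⟩ ⟨z, hz⟩
    simp only at this
    rw [this]
    exact Real.tanh_lt_one _
  let c : ℂ → ℂ := fun ζ => (a - conj (a : ℂ) * ζ) / (1 - ζ)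
  have h1ζ : ∀ {ζ : ℂ}, ‖ζ‖ < 1 → 1 - ζ ≠ 0 := by
    intro ζ hζ h
    rw [← sub_eq_zero.1 h] at hζ
    simp at hζ
  have hcH : ∀ {ζ : ℂ}, ‖ζ‖ < 1 → 0 < (c ζ).im := by
    intro ζ hζ
    have h0 := h1ζ hζ
    have hpos : 0 < Complex.normSq (1 - ζ) := Complex.normSq_pos.2 h0
    have hsq : Complex.normSq ζ < 1 := by
      rw [Complex.normSq_eq_norm_sq]
      nlinarith [norm_nonneg ζ]
    have : (c ζ).im = a.im * (1 - Complex.normSq ζ) / Complex.normSq (1 - ζ) := by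
      simp only [c, Complex.div_im, Complex.sub_re, Complex.sub_im, Complex.mul_re, Complex.mul_im,
        Complex.conj_re, Complex.conj_im, Complex.one_re, Complex.one_im, coe_re, coe_im]
      field_simp
      simp only [Complex.normSq_apply]
      ring
    rw [this]
    exact div_pos (mul_pos a.im_pos (by linarith)) hpos
  have hcq : ∀ {z : ℂ}, 0 < z.im → c (q a z) = z := by
    intro z hz
    have h1 := hden a.im_pos hz
    have h2 := h1ζ (hqlt a.im_pos hz)
    have h3 : (a : ℂ) - conj (a : ℂ) ≠ 0 := hden a.im_pos a.im_pos
    simp only [c]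
    rw [div_eq_iff h2]
    simp only [q]
    field_simp
    ring
  have hTH : ∀ {z : ℂ}, 0 < z.im → 0 < (T z).im := fun {z} hz => hmaps ⟨z, hz⟩
  -- `T` in disc coordinates, fixing `0`. The Schwarz lemma gives the inequality; equality at one
  -- nonzero point makes `Φ` a rotation, so `T` is injective.
  let Φ : ℂ → ℂ := fun ζ => q (T a) (T (c ζ))
  have hΦ0 : Φ 0 = 0 := by simp [Φ, c, q]
  have hball : ∀ {ζ : ℂ}, ζ ∈ Metric.ball (0 : ℂ) 1 → ‖ζ‖ < 1 := fun h => mem_ball_zero_iff.1 h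
  have hΦd : DifferentiableOn ℂ Φ (Metric.ball 0 1) := by
    have hcd : DifferentiableOn ℂ c (Metric.ball 0 1) :=
      DifferentiableOn.div (by fun_prop) (by fun_prop) fun ζ hζ => h1ζ (hball hζ)
    have hTc : DifferentiableOn ℂ (fun ζ => T (c ζ)) (Metric.ball 0 1) :=
      hT.comp hcd fun ζ hζ => hcH (hball hζ)
    exact DifferentiableOn.div (hTc.sub_const _) (hTc.sub_const _)
      fun ζ hζ => hden (hTH a.im_pos) (hTH (hcH (hball hζ)))
  have hΦm : Set.MapsTo Φ (Metric.ball 0 1) (Metric.closedBall (Φ 0) 1) := by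
    intro ζ hζ
    rw [hΦ0, mem_closedBall_zero_iff]
    exact (hqlt (hTH a.im_pos) (hTH (hcH (hball hζ)))).le
  have hqb : q a b ∈ Metric.ball (0 : ℂ) 1 := mem_ball_zero_iff.2 (hqlt a.im_pos b.im_pos)
  have hΦb : Φ (q a b) = q (T a) (T b) := by simp only [Φ, hcq b.im_pos]
  have hd1 := hqdist a b
  have hd2 := hqdist ⟨T a, hmaps a⟩ ⟨T b, hmaps b⟩
  simp only at hd2
  constructor
  · have := Complex.dist_le_dist_of_mapsTo_ball hΦd hΦm hqb
    rw [hΦ0, hΦb, dist_zero_right, dist_zero_right, hd1, hd2] at this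
    have := Real.artanh_le_artanh (Real.neg_one_lt_tanh _) (Real.tanh_lt_one _) this
    rw [Real.artanh_tanh, Real.artanh_tanh] at this
    linarith
  · intro hab heq
    have hq0 : q a b ≠ 0 := by
      refine div_ne_zero (sub_ne_zero.2 fun h => hab ?_) (hden a.im_pos b.im_pos)
      exact UpperHalfPlane.ext h.symm
    have hslope : ‖dslope Φ 0 (q a b)‖ = 1 / 1 := by
      rw [dslope_of_ne _ hq0, slope_def_field, hΦ0, hΦb, sub_zero, sub_zero, norm_div, hd1, hd2,
        heq, ← hd1, div_self (norm_ne_zero_iff.2 hq0), div_one]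
    have haff := Complex.affine_of_mapsTo_ball_of_norm_dslope_eq_div hΦd hΦm hqb hslope
    have hC : dslope Φ 0 (q a b) ≠ 0 := by
      rw [← norm_ne_zero_iff, hslope]
      norm_num
    intro x hx y hy hxy
    have hx' : 0 < x.im := hx
    have hy' : 0 < y.im := hy
    have h1 : Φ (q a x) = Φ (q a y) := by simp only [Φ, hcq hx', hcq hy', hxy]
    rw [haff (mem_ball_zero_iff.2 (hqlt a.im_pos hx')),
      haff (mem_ball_zero_iff.2 (hqlt a.im_pos hy'))] at h1
    simp only [sub_zero, add_right_inj, smul_eq_mul] at h1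
    rw [← hcq hx', ← hcq hy', mul_right_cancel₀ hC h1]

namespace IsHolomorphicUniversalCover

variable {π : ℂ → ℂ} {U : Set ℂ}

theorem mem (h : IsHolomorphicUniversalCover π U) (a : UpperHalfPlane) : π a ∈ U :=
  h.2.1 ▸ Set.mem_range_self a

/-- A holomorphic universal cover of a simply connected open set is injective. -/
theorem injOn (h : IsHolomorphicUniversalCover π U) (hU : IsOpen U) (hUc : IsSimplyConnected U) :
    Set.InjOn π {a | 0 < a.im} := by
  have hcov := h.2.2
  have := hUc.simplyConnectedSpace
  have := hU.locallyPathConnectedSpace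
  have hπc : Continuous fun a : UpperHalfPlane => π a :=
    h.1.continuousOn.comp_continuous UpperHalfPlane.continuous_coe fun a => a.im_pos
  have hinj : Function.Injective fun a : UpperHalfPlane => π a := by
    intro a b hab
    -- Simple connectedness of `U` lifts the inclusion to a section `s` through `a`. Both `s ∘ π`
    -- and the identity lift `π` and agree at `a`, hence everywhere.
    obtain ⟨s, ⟨hs, hs'⟩, -⟩ := hcov.existsUnique_continuousMap_lifts
      (⟨Subtype.val, continuous_subtype_val⟩ : C(U, ℂ)) (a₀ := ⟨π a, h.mem a⟩) (e₀ := a) rfl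
      (fun x => x.2)
    have huniq := hcov.existsUnique_continuousMap_lifts
      (⟨fun a : UpperHalfPlane => π a, hπc⟩ : C(UpperHalfPlane, ℂ)) (a₀ := a) (e₀ := a) rfl
      (fun x => h.mem x)
    have heq := huniq.unique (y₁ := ContinuousMap.id _)
      (y₂ := s.comp ⟨fun a => ⟨π a, h.mem a⟩, hπc.subtype_mk _⟩) ⟨rfl, rfl⟩
      ⟨hs, funext fun x => congrFun hs' ⟨π x, h.mem x⟩⟩
    have h1 : a = s ⟨π a, h.mem a⟩ := congrArg (fun g => g a) heq
    have h2 : b = s ⟨π b, h.mem b⟩ := congrArg (fun g => g b) heq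
    rw [h1, h2]
    congr 1
    exact Subtype.ext hab
  intro a ha b hb hab
  exact congrArg UpperHalfPlane.coe (hinj (a₁ := ⟨a, ha⟩) (a₂ := ⟨b, hb⟩) hab)

theorem image_eq (h : IsHolomorphicUniversalCover π U) : π '' {a | 0 < a.im} = U := by
  rw [← h.2.1]
  ext z
  constructor
  · rintro ⟨a, ha, rfl⟩
    exact ⟨⟨a, ha⟩, rfl⟩
  · rintro ⟨a, rfl⟩
    exact ⟨a, a.im_pos, rfl⟩

/-- A holomorphic map between simply connected domains lifts to the universal covers. -/
theorem exists_lift (h : IsHolomorphicUniversalCover π U) {π' f : ℂ → ℂ} {U' : Set ℂ}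
    (h' : IsHolomorphicUniversalCover π' U') (hU' : IsOpen U') (hUc' : IsSimplyConnected U')
    (hf : DifferentiableOn ℂ f U) (hmaps : Set.MapsTo f U U') :
    ∃ T : ℂ → ℂ, DifferentiableOn ℂ T {a | 0 < a.im} ∧
      (∀ a : UpperHalfPlane, 0 < (T a).im) ∧ ∀ a : UpperHalfPlane, π' (T a) = f (π a) := by
  have hH : IsOpen {a : ℂ | 0 < a.im} := isOpen_lt continuous_const Complex.continuous_im
  have hinj := h'.injOn hU' hUc'
  have hσ := differentiableOn_invFunOn_image hH h'.1 hinj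
  rw [h'.image_eq] at hσ
  have hsurj : ∀ z ∈ U', z ∈ π' '' {a | 0 < a.im} := fun z hz => by rwa [h'.image_eq]
  have hmem : ∀ a : UpperHalfPlane, f (π a) ∈ U' := fun a => hmaps (h.mem a)
  refine ⟨fun a => Function.invFunOn π' {a | 0 < a.im} (f (π a)), ?_, fun a => ?_, fun a => ?_⟩
  · exact hσ.comp (hf.comp h.1 fun a ha => h.mem ⟨a, ha⟩) fun a ha => hmem ⟨a, ha⟩
  · exact Function.invFunOn_mem (hsurj _ (hmem a))
  · exact Function.invFunOn_eq (hsurj _ (hmem a))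

/-- The hyperbolic distance of a simply connected domain, computed by any universal cover. -/
theorem hyperbolicDist_eq (h : IsHolomorphicUniversalCover π U) (hU : IsOpen U)
    (hUc : IsSimplyConnected U) (a b : UpperHalfPlane) :
    hyperbolicDist U (π a) (π b) = dist a b := by
  -- Lifting the identity from one cover to another does not increase distances. By symmetry all
  -- covers give the same value, and the infimum is over a singleton.
  have key : ∀ {π₁ π₂ : ℂ → ℂ}, IsHolomorphicUniversalCover π₁ U →
      IsHolomorphicUniversalCover π₂ U → ∀ a b a' b' : UpperHalfPlane, π₁ a = π₂ a' →
      π₁ b = π₂ b' → dist a' b' ≤ dist a b := by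
    intro π₁ π₂ h₁ h₂ a b a' b' ha hb
    obtain ⟨T, hT, hTm, hTe⟩ := h₁.exists_lift h₂ hU hUc differentiableOn_id (Set.mapsTo_id U)
    have hinj := h₂.injOn hU hUc
    have e1 : (⟨T a, hTm a⟩ : UpperHalfPlane) = a' :=
      UpperHalfPlane.ext (hinj (hTm a) a'.im_pos ((hTe a).trans ha))
    have e2 : (⟨T b, hTm b⟩ : UpperHalfPlane) = b' :=
      UpperHalfPlane.ext (hinj (hTm b) b'.im_pos ((hTe b).trans hb))
    have := (schwarzPick_upperHalfPlane hT hTm a b).1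
    rwa [e1, e2] at this
  have hset : {t | ∃ π' : ℂ → ℂ, IsHolomorphicUniversalCover π' U ∧
      ∃ a' b' : UpperHalfPlane, π' a' = π a ∧ π' b' = π b ∧ t = dist a' b'} = {dist a b} := by
    ext t
    constructor
    · rintro ⟨π', h', a', b', ha, hb, rfl⟩
      exact le_antisymm (key h h' a b a' b' ha.symm hb.symm) (key h' h a' b' a b ha hb)
    · rintro rfl
      exact ⟨π, h, a, b, rfl, rfl, rfl⟩
  rw [hyperbolicDist, hset, csInf_singleton]

end IsHolomorphicUniversalCover

/-- Without a cover the infimum is over the empty set and equals `0`. Hence positive distances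
themselves supply the covers, and no uniformization theorem is needed. -/
theorem exists_isHolomorphicUniversalCover_of_hyperbolicDist_ne_zero {U : Set ℂ} {z w : ℂ}
    (h : hyperbolicDist U z w ≠ 0) : ∃ (π : ℂ → ℂ) (a b : UpperHalfPlane),
      IsHolomorphicUniversalCover π U ∧ π a = z ∧ π b = w := by
  by_contra! hne
  refine h ?_
  have hset : {t | ∃ π : ℂ → ℂ, IsHolomorphicUniversalCover π U ∧
      ∃ a b : UpperHalfPlane, π a = z ∧ π b = w ∧ t = dist a b} = ∅ := by
    rw [Set.eq_empty_iff_forall_notMem]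
    rintro t ⟨π, hπ, a, b, ha, hb, -⟩
    exact hne π a b hπ ha hb
  rw [hyperbolicDist, hset, Real.sInf_empty]

/-- A holomorphic map between simply connected domains that preserves one positive hyperbolic
distance is injective. -/
theorem injOn_of_hyperbolicDist_eq {f : ℂ → ℂ} {U U' : Set ℂ} (hU : IsOpen U)
    (hUc : IsSimplyConnected U) (hU' : IsOpen U') (hUc' : IsSimplyConnected U')
    (hf : DifferentiableOn ℂ f U) (hmaps : Set.MapsTo f U U') {z w : ℂ}
    (h0 : hyperbolicDist U z w ≠ 0)
    (heq : hyperbolicDist U' (f z) (f w) = hyperbolicDist U z w) : Set.InjOn f U := by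
  obtain ⟨π, a, b, hπ, rfl, rfl⟩ := exists_isHolomorphicUniversalCover_of_hyperbolicDist_ne_zero h0
  obtain ⟨π', a', b', hπ', -, -⟩ :=
    exists_isHolomorphicUniversalCover_of_hyperbolicDist_ne_zero (heq ▸ h0)
  obtain ⟨T, hT, hTm, hTe⟩ := hπ.exists_lift hπ' hU' hUc' hf hmaps
  rw [← hTe, ← hTe, hπ.hyperbolicDist_eq hU hUc] at heq
  rw [hπ.hyperbolicDist_eq hU hUc] at h0
  have heq' := (hπ'.hyperbolicDist_eq hU' hUc' ⟨T a, hTm a⟩ ⟨T b, hTm b⟩).symm.trans heq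
  have hinj := (schwarzPick_upperHalfPlane hT hTm a b).2 (dist_ne_zero.1 h0) heq'
  intro x hx y hy hxy
  rw [← hπ.image_eq] at hx hy
  obtain ⟨x, hx, rfl⟩ := hx
  obtain ⟨y, hy, rfl⟩ := hy
  have h1 := hTe ⟨x, hx⟩
  have h2 := hTe ⟨y, hy⟩
  have : T x = T y := by
    refine hπ'.injOn hU' hUc' (hTm ⟨x, hx⟩) (hTm ⟨y, hy⟩) ?_
    exact h1.trans (hxy.trans h2.symm)
  rw [hinj hx hy this]

/-! ### Fatou components and eventual injectivity. -/

theorem isOpen_fatouSet (f : ℂ → ℂ) : IsOpen (fatouSet f) := by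
  rw [isOpen_iff_mem_nhds]
  rintro z ⟨V, hV, hz, hN⟩
  exact mem_of_superset (hV.mem_nhds hz) fun w hw => ⟨V, hV, hw, hN⟩

namespace IsFatouComponent

variable {f : ℂ → ℂ} {U U' : Set ℂ}

theorem isOpen (h : IsFatouComponent f U) : IsOpen U := by
  obtain ⟨z, -, rfl⟩ := h
  exact (isOpen_fatouSet f).connectedComponentIn

theorem nonempty (h : IsFatouComponent f U) : U.Nonempty := by
  obtain ⟨z, hz, rfl⟩ := h
  exact ⟨z, mem_connectedComponentIn hz⟩

theorem fatouComponent_eq (h : IsFatouComponent f U) {z : ℂ} (hz : z ∈ U) :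
    fatouComponent f z = U := by
  obtain ⟨w, -, rfl⟩ := h
  exact (connectedComponentIn_eq hz).symm

theorem eq_or_disjoint (h : IsFatouComponent f U) (h' : IsFatouComponent f U') :
    U = U' ∨ Disjoint U U' := by
  rw [or_iff_not_imp_right, Set.not_disjoint_iff]
  rintro ⟨z, hz, hz'⟩
  rw [← h.fatouComponent_eq hz, ← h'.fatouComponent_eq hz']

end IsFatouComponent

theorem mapsTo_iterate_add {f : ℂ → ℂ} {U : ℕ → Set ℂ}
    (hmaps : ∀ n, Set.MapsTo f (U n) (U (n + 1))) (n j : ℕ) :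
    Set.MapsTo f^[n] (U j) (U (j + n)) := by
  induction n with
  | zero => exact fun z hz => hz
  | succ n ih =>
    intro z hz
    rw [Function.iterate_succ_apply']
    exact hmaps _ (ih hz)

/-- Wandering domains that are mapped successively into each other are pairwise disjoint. -/
theorem pairwise_disjoint_of_isWanderingDomain {f : ℂ → ℂ} {U : ℕ → Set ℂ}
    (hmaps : ∀ n, Set.MapsTo f (U n) (U (n + 1))) (hw : ∀ n, IsWanderingDomain f (U n)) :
    Pairwise fun i j => Disjoint (U i) (U j) := by
  -- If `U i = U (i + k)`, then `f^k z` would lie both in `f^k(U i)` and in `f^0(U i)`.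
  have key : ∀ i k : ℕ, 0 < k → Disjoint (U i) (U (i + k)) := by
    intro i k hk
    refine ((hw i).1.eq_or_disjoint (hw (i + k)).1).resolve_left fun heq => ?_
    obtain ⟨z, hz⟩ := (hw i).1.nonempty
    refine Set.disjoint_left.1 ((hw i).2 k 0 hk.ne') ⟨z, hz, rfl⟩ ⟨f^[k] z, ?_, rfl⟩
    rw [heq]
    exact mapsTo_iterate_add hmaps k i hz
  intro i j hij
  rcases lt_or_gt_of_ne hij with h | h
  · obtain ⟨k, rfl⟩ := Nat.exists_eq_add_of_lt h
    exact key i (k + 1) k.succ_pos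
  · obtain ⟨k, rfl⟩ := Nat.exists_eq_add_of_lt h
    exact (key j (k + 1) k.succ_pos).symm

/-- The fibres of a nonconstant entire function are countable. -/
theorem countable_fiber_of_differentiable {f : ℂ → ℂ} (hf : Differentiable ℂ f) {c : ℂ}
    (hc : ¬ ∀ z, f z = c) : {z | f z = c}.Countable := by
  have han : AnalyticOnNhd ℂ (fun z => f z - c) Set.univ :=
    (hf.sub_const c).differentiableOn.analyticOnNhd isOpen_univ
  rcases han.eqOn_zero_or_eventually_ne_zero_of_preconnected isPreconnected_univ with h | h
  · exact absurd (fun z => sub_eq_zero.1 (h (Set.mem_univ z))) hc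
  · have hd := (mem_codiscrete'.1 h).2
    have hset : {z | f z - c ≠ 0}ᶜ = {z | f z = c} := by
      ext z
      simp [sub_eq_zero]
    rw [hset] at hd
    exact (HereditarilyLindelofSpace.isLindelof _).countable_of_isDiscrete hd

namespace IsTranscendentalEntire

variable {f : ℂ → ℂ}

theorem countable_iterate_fiber (hf : IsTranscendentalEntire f) (k : ℕ) (c : ℂ) :
    {z | f^[k] z = c}.Countable := by
  have hbase : ∀ c, {z | f z = c}.Countable := fun c =>
    countable_fiber_of_differentiable hf.1 fun h => hf.2 ⟨Polynomial.C c, fun z => by simp [h z]⟩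
  induction k with
  | zero => simp
  | succ k ih =>
    refine (ih.biUnion fun y _ => hbase y).mono fun z hz => ?_
    exact Set.mem_biUnion (x := f z) (by simpa using hz) rfl

/-- A point of an open set whose orbit never meets the orbit of a given point. -/
theorem exists_forall_iterate_ne (hf : IsTranscendentalEntire f) {U : Set ℂ} (hU : IsOpen U)
    (hne : U.Nonempty) (z : ℂ) : ∃ w ∈ U, ∀ k, f^[k] z ≠ f^[k] w := by
  have hc : (⋃ k, {w | f^[k] w = f^[k] z}).Countable :=
    Set.countable_iUnion fun k => hf.countable_iterate_fiber k _
  obtain ⟨w, hwU, hw⟩ := (hc.dense_compl ℂ).inter_open_nonempty U hU hne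
  exact ⟨w, hwU, fun k hk => hw (Set.mem_iUnion.2 ⟨k, hk.symm⟩)⟩

end IsTranscendentalEntire

/-- Along a sequence of eventually isometric wandering domains, the function is eventually
injective. -/
theorem exists_forall_ge_injOn_of_isEventuallyIsometric {f : ℂ → ℂ}
    (hf : IsTranscendentalEntire f) {U : ℕ → Set ℂ}
    (hmaps : ∀ n, Set.MapsTo f (U n) (U (n + 1)))
    (hiso : ∀ n, IsEventuallyIsometricWanderingDomain f (U n)) :
    ∃ N : ℕ, ∀ n ≥ N, Set.InjOn f (U n) := by
  have hcomp : ∀ n, IsFatouComponent f (U n) := fun n => (hiso n).1.1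
  obtain ⟨z, hz⟩ := (hcomp 0).nonempty
  -- The isometry hypothesis concerns only pairs whose orbits never meet. Iterates have countable
  -- fibres, so all but countably many `w` qualify.
  obtain ⟨w, hw, hzw⟩ := hf.exists_forall_iterate_ne (hcomp 0).isOpen (hcomp 0).nonempty z
  obtain ⟨N, -, hN⟩ := (hiso 0).2.2
  obtain ⟨c, hc, hdist⟩ := hN z hz w hw hzw
  have hd : ∀ n ≥ N, hyperbolicDist (U n) (f^[n] z) (f^[n] w) = c := by
    intro n hn
    have hmem := mapsTo_iterate_add hmaps n 0 hz
    rw [zero_add] at hmem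
    have := hdist n hn
    rwa [(hcomp n).fatouComponent_eq hmem] at this
  refine ⟨N, fun n hn => ?_⟩
  refine injOn_of_hyperbolicDist_eq (hcomp n).isOpen (hiso n).2.1 (hcomp (n + 1)).isOpen
    (hiso (n + 1)).2.1 hf.1.differentiableOn (hmaps n) (z := f^[n] z) (w := f^[n] w) ?_ ?_
  · rw [hd n hn]
    exact hc.ne'
  · rw [hd n hn, ← Function.iterate_succ_apply' f n z, ← Function.iterate_succ_apply' f n w,
      hd (n + 1) (by omega)]

/-! ### Simultaneous polynomial approximation. -/

/-- A sequence of pairwise disjoint nonempty open sets does not cover the plane. -/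
theorem exists_notMem_iUnion_of_pairwise_disjoint {U : ℕ → Set ℂ} (hU : ∀ n, IsOpen (U n))
    (hne : ∀ n, (U n).Nonempty) (hd : Pairwise fun i j => Disjoint (U i) (U j)) :
    ∃ q, q ∉ ⋃ n, U n := by
  by_contra! hall
  have hclosed : IsClosed (U 0) := by
    rw [← isOpen_compl_iff]
    have : (U 0)ᶜ = ⋃ n, U (n + 1) := by
      ext z
      constructor
      · intro hz
        obtain ⟨n, hn⟩ := Set.mem_iUnion.1 (hall z)
        cases n with
        | zero => exact absurd hn hz
        | succ n => exact Set.mem_iUnion.2 ⟨n, hn⟩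
      · intro hz h0
        obtain ⟨n, hn⟩ := Set.mem_iUnion.1 hz
        exact Set.disjoint_left.1 (hd n.succ_ne_zero) hn h0
    rw [this]
    exact isOpen_iUnion fun n => hU _
  have huniv := IsClopen.eq_univ ⟨hclosed, hU 0⟩ (hne 0)
  obtain ⟨z, hz⟩ := hne 1
  exact Set.disjoint_left.1 (hd one_ne_zero) hz (huniv ▸ Set.mem_univ z)

/-- If subsequences of the iterates tend to infinity on each of the sets `U n`, then some iterate
maps a given compact subset of their union off a given disc. -/
theorem exists_iterate_norm_gt {f : ℂ → ℂ} (hf : Continuous f) {U : ℕ → Set ℂ}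
    (hU : ∀ n, IsOpen (U n)) (hd : Pairwise fun i j => Disjoint (U i) (U j))
    (hmaps : ∀ n, Set.MapsTo f (U n) (U (n + 1)))
    (hinf : ∀ n, ∃ φ : ℕ → ℕ, TendsToInftyLocallyUniformlyOn (fun j => f^[φ j]) (U n))
    {K : Set ℂ} (hK : IsCompact K) (hKU : K ⊆ ⋃ n, U n) (R : ℝ) :
    ∃ n, ∀ z ∈ K, R < ‖f^[n] z‖ := by
  obtain ⟨s, hs⟩ := hK.elim_finite_subcover U hU hKU
  obtain ⟨J, hJ⟩ : ∃ J, ∀ j ∈ s, j ≤ J := ⟨s.sup id, fun j hj => Finset.le_sup (f := id) hj⟩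
  obtain ⟨φ, hφ⟩ := hinf J
  have hcpt : ∀ j, IsCompact (K ∩ U j) := by
    intro j
    have : K ∩ U j = K \ ⋃ i ∈ {i | i ≠ j}, U i := by
      ext z
      constructor
      · rintro ⟨hzK, hz⟩
        refine ⟨hzK, fun h => ?_⟩
        obtain ⟨i, hi, hzi⟩ := Set.mem_iUnion₂.1 h
        exact Set.disjoint_left.1 (hd hi) hzi hz
      · rintro ⟨hzK, hz⟩
        refine ⟨hzK, ?_⟩
        obtain ⟨i, hi⟩ := Set.mem_iUnion.1 (hKU hzK)
        by_cases hij : i = j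
        · exact hij ▸ hi
        · exact absurd (Set.mem_iUnion₂.2 ⟨i, hij, hi⟩) hz
    rw [this]
    exact hK.diff (isOpen_biUnion fun i _ => hU i)
  have hev : ∀ j ∈ s, ∀ᶠ t in atTop, ∀ z ∈ K ∩ U j, R < ‖f^[φ t] z‖ := by
    intro j hj
    -- Different `U j` may escape along different subsequences. Pushing every piece of `K` forward
    -- into the single domain `U J` allows one subsequence `φ` for all.
    have hmap : f^[J - j] '' (K ∩ U j) ⊆ U J := by
      rintro _ ⟨z, hz, rfl⟩
      have := mapsTo_iterate_add hmaps (J - j) j hz.2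
      rwa [Nat.add_sub_cancel' (hJ j hj)] at this
    -- If `f^[φ t] z` were still in the disc of radius `R`, applying `f^[J - j]` would keep it
    -- within `B`; but the iterates commute and the images in `U J` leave that disc.
    obtain ⟨B, hB⟩ := ((isCompact_closedBall (0 : ℂ) R).image
      (hf.iterate (J - j))).isBounded.subset_closedBall 0
    filter_upwards [hφ _ hmap ((hcpt j).image (hf.iterate _)) B] with t ht z hz
    by_contra! hle
    have h1 := ht _ ⟨z, hz, rfl⟩
    rw [← Function.iterate_add_apply, add_comm, Function.iterate_add_apply] at h1
    have h2 := mem_closedBall_zero_iff.1 (hB ⟨_, mem_closedBall_zero_iff.2 hle, rfl⟩)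
    linarith
  obtain ⟨t, ht⟩ := ((Filter.eventually_all_finset s).2 hev).exists
  refine ⟨φ t, fun z hz => ?_⟩
  obtain ⟨j, hj, hzj⟩ := Set.mem_iUnion₂.1 (hs hz)
  exact ht j hj z ⟨hz, hzj⟩

/-- Simultaneous approximation of `g₀` on a disc and of `H` on a compact subset of `⋃ n, U n` by a
polynomial and its composition with an iterate of `f`. -/
theorem exists_polynomial_approx_and_comp_iterate_approx {f : ℂ → ℂ} (hf : Differentiable ℂ f)
    {U : ℕ → Set ℂ} (hU : ∀ n, IsOpen (U n)) (hUc : ∀ n, IsSimplyConnected (U n))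
    (hd : Pairwise fun i j => Disjoint (U i) (U j))
    (hmaps : ∀ n, Set.MapsTo f (U n) (U (n + 1))) (hinj : ∀ n, Set.InjOn f (U n))
    (hinf : ∀ n, ∃ φ : ℕ → ℕ, TendsToInftyLocallyUniformlyOn (fun j => f^[φ j]) (U n))
    {K : Set ℂ} (hK : IsCompact K) (hKU : K ⊆ ⋃ n, U n) {g₀ H : ℂ → ℂ}
    (hg₀ : Differentiable ℂ g₀) (hH : DifferentiableOn ℂ H (⋃ n, U n)) (R : ℝ) {ε : ℝ}
    (hε : 0 < ε) : ∃ (p : Polynomial ℂ) (n : ℕ), (∀ z, ‖z‖ ≤ R → ‖g₀ z - p.eval z‖ < ε) ∧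
      ∀ z ∈ K, ‖H z - p.eval (f^[n] z)‖ < ε := by
  classical
  set M := ⋃ n, U n with hMdef
  have hM : IsOpen M := isOpen_iUnion hU
  obtain ⟨q, hq⟩ := exists_notMem_iUnion_of_pairwise_disjoint hU (fun n => (hUc n).nonempty) hd
  -- The disc is enlarged to contain `q`, a point outside all `U n`; this later keeps it from lying
  -- in a hole of `F '' K`.
  set R₁ := max R ‖q‖ with hR₁
  obtain ⟨n, hn⟩ := exists_iterate_norm_gt hf.continuous hU hd hmaps hinf hK hKU R₁
  set F := f^[n] with hF
  have hFd : Differentiable ℂ F := hf.iterate n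
  have hFmaps : ∀ j, Set.MapsTo F (U j) (U (j + n)) := mapsTo_iterate_add hmaps n
  have hFinjU : ∀ m j, Set.InjOn f^[m] (U j) := by
    intro m
    induction m with
    | zero => exact fun j => Function.injective_id.injOn
    | succ m ih =>
      intro j
      rw [Function.iterate_succ]
      exact (ih (j + 1)).comp (hinj j) (hmaps j)
  have hFinj : Set.InjOn F M := by
    intro x hx y hy hxy
    obtain ⟨i, hi⟩ := Set.mem_iUnion.1 hx
    obtain ⟨j, hj⟩ := Set.mem_iUnion.1 hy
    have hij : i = j := by
      by_contra hne
      refine Set.disjoint_left.1 (hd (i := i + n) (j := j + n) (by omega)) (hFmaps i hi) ?_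
      rw [hxy]
      exact hFmaps j hj
    subst hij
    exact hFinjU n i hi hj hxy
  set G := Function.invFunOn F M with hG
  have hGF : ∀ z ∈ M, G (F z) = z := fun z hz => hFinj.leftInvOn_invFunOn hz
  have hFM : IsOpen (F '' M) :=
    isOpen_image_of_injOn_differentiableOn hM hFd.differentiableOn hFinj hM subset_rfl
  have hGd : DifferentiableOn ℂ G (F '' M) :=
    differentiableOn_invFunOn_image hM hFd.differentiableOn hFinj
  have hGm : Set.MapsTo G (F '' M) M := by
    rintro _ ⟨z, hz, rfl⟩
    rwa [hGF z hz]
  have hFK : IsCompact (F '' K) := hK.image hFd.continuous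
  have hFKM : F '' K ⊆ F '' M := Set.image_mono hKU
  -- the hull of `F '' K` stays inside `F '' M`
  have hhull : planeHull (F '' K) ⊆ F '' M := by
    intro w hw
    by_contra hwM
    refine not_isBounded_connectedComponentIn_of_hasContinuousLogOn hFK (fun h => hwM (hFKM h)) ?_
      (mem_planeHull.1 hw)
    -- On each simply connected `U j` the zero-free function `F - w` has a logarithm. Transported by
    -- `G`, it is a logarithm of `z - w` on `F '' M`, contradicting Eilenberg's criterion.
    have hlogM : HasContinuousLogOn (fun z => F z - w) M := by
      refine HasContinuousLogOn.iUnion_of_isOpen hU hd fun j => ?_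
      refine Complex.exists_continuousOn_eqOn_exp_comp (hUc j) (hU j)
        (hFd.continuous.sub continuous_const).continuousOn ?_
      rintro ⟨z, hz, hzw⟩
      exact hwM ⟨z, Set.mem_iUnion.2 ⟨j, hz⟩, sub_eq_zero.1 hzw⟩
    obtain ⟨l, hl, hexp⟩ := hlogM
    refine HasContinuousLogOn.mono (L := F '' M) ⟨fun z => l (G z),
      hl.comp hGd.continuousOn hGm, ?_⟩ hFKM
    rintro _ ⟨z, hz, rfl⟩
    simp only [hGF z hz, hexp z hz]
  set E₁ := planeHull (F '' K) with hE₁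
  have hE₁c : IsCompact E₁ := isCompact_planeHull hFK
  set L := Metric.closedBall (0 : ℂ) R₁ with hL
  have hLc : IsCompact L := isCompact_closedBall _ _
  have hLFK : L ⊆ (F '' K)ᶜ := by
    rintro _ hz ⟨z, hzK, rfl⟩
    have := mem_closedBall_zero_iff.1 hz
    linarith [hn z hzK]
  -- The disc is connected and misses `F '' K`, so if it met the hull it would lie in one hole
  -- together with `q`. But the hull is inside `F '' M ⊆ M`.
  have hLE : Disjoint L E₁ := by
    rw [Set.disjoint_left]
    intro x hx hxE
    have hqL : q ∈ L := mem_closedBall_zero_iff.2 (le_max_right _ _)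
    have hqx : q ∈ connectedComponentIn (F '' K)ᶜ x :=
      (convex_closedBall (0 : ℂ) R₁).isPreconnected.subset_connectedComponentIn hx hLFK hqL
    have hqE : q ∈ E₁ := by
      rw [hE₁, mem_planeHull, ← connectedComponentIn_eq hqx]
      exact mem_planeHull.1 hxE
    obtain ⟨z, hz, rfl⟩ := hhull hqE
    obtain ⟨j, hj⟩ := Set.mem_iUnion.1 hz
    exact hq (Set.mem_iUnion.2 ⟨_, hFmaps j hj⟩)
  obtain ⟨V₀, V₁, hV₀, hV₁, hLV, hEV, hV⟩ := SeparatedNhds.of_isCompact_isCompact hLc hE₁c hLE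
  -- The target for Runge's theorem: `g₀` near the disc and `H ∘ F⁻¹` near the hull.
  let φ : ℂ → ℂ := V₀.piecewise g₀ (fun z => H (G z))
  have hφ₀ : ∀ z ∈ V₀, φ z = g₀ z := fun z hz => Set.piecewise_eq_of_mem _ _ _ hz
  have hφ₁ : ∀ z ∈ V₁, φ z = H (G z) := fun z hz =>
    Set.piecewise_eq_of_notMem _ _ _ (Set.disjoint_right.1 hV hz)
  have hφ : DifferentiableOn ℂ φ (V₀ ∪ V₁ ∩ F '' M) := by
    rintro z (hz | hz)
    · refine DifferentiableAt.differentiableWithinAt ?_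
      refine (hg₀ z).congr_of_eventuallyEq ?_
      filter_upwards [hV₀.mem_nhds hz] with w hw using hφ₀ w hw
    · refine DifferentiableAt.differentiableWithinAt ?_
      refine ((hH.comp hGd hGm).differentiableAt (hFM.mem_nhds hz.2)).congr_of_eventuallyEq ?_
      filter_upwards [hV₁.mem_nhds hz.1] with w hw using hφ₁ w hw
  have hfull : ∀ w ∉ L ∪ E₁, HasContinuousLogOn (fun z => z - w) (L ∪ E₁) := by
    intro w hw
    rw [Set.mem_union, not_or] at hw
    refine HasContinuousLogOn.union_of_isClosed hLc.isClosed hE₁c.isClosed hLE ?_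
      (hasContinuousLogOn_planeHull hFK hw.2)
    refine HasContinuousLogOn.sub_of_subset_closedBall subset_rfl ?_
    simpa [hL] using hw.1
  obtain ⟨p, hp⟩ := exists_polynomial_approx_of_hasContinuousLogOn (hLc.union hE₁c) hfull
    (hV₀.union (hV₁.inter hFM)) (Set.union_subset_union hLV (Set.subset_inter hEV hhull)) hφ hε
  refine ⟨p, n, fun z hz => ?_, fun z hz => ?_⟩
  · have hzL : z ∈ L := mem_closedBall_zero_iff.2 (hz.trans (le_max_left _ _))
    rw [← hφ₀ z (hLV hzL)]
    exact hp z (Or.inl hzL)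
  · have hzE : F z ∈ E₁ := subset_planeHull _ ⟨z, hz, rfl⟩
    have := hp (F z) (Or.inr hzE)
    rwa [hφ₁ _ (hEV hzE), hGF z (hKU hz)] at this

/-! ### The Baire category argument. -/

/-- Neighbourhoods in `C(X, ℂ)` in terms of uniform approximation on compact sets. -/
theorem exists_isCompact_forall_norm_sub_lt_mem {X : Type*} [TopologicalSpace X]
    {O : Set C(X, ℂ)} (hO : IsOpen O) {g : C(X, ℂ)} (hg : g ∈ O) :
    ∃ K : Set X, IsCompact K ∧ ∃ ε > 0, ∀ g' : C(X, ℂ), (∀ x ∈ K, ‖g x - g' x‖ < ε) → g' ∈ O := by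
  have hb := nhds_basis_uniformity
    (Metric.uniformity_basis_dist (α := ℂ)).compactConvergenceUniformity (x := g)
  obtain ⟨⟨K, ε⟩, ⟨hK, hε⟩, hsub⟩ := hb.mem_iff.1 (hO.mem_nhds hg)
  refine ⟨K, hK, ε, hε, fun g' hg' => hsub fun x hx => ?_⟩
  change dist (g' x) (g x) < ε
  rw [dist_comm, dist_eq_norm]
  exact hg' x hx

/-- Weierstrass' theorem on locally uniform limits; it makes the space of entire functions complete,
hence Baire. -/
theorem isClosed_setOf_differentiable : IsClosed {g : C(ℂ, ℂ) | Differentiable ℂ g} := by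
  refine isClosed_of_closure_subset fun g hg => ?_
  have hne := mem_closure_iff_nhdsWithin_neBot.1 hg
  have ht : Tendsto (fun h : C(ℂ, ℂ) => h) (𝓝[{g : C(ℂ, ℂ) | Differentiable ℂ g}] g) (𝓝 g) :=
    tendsto_id.mono_left nhdsWithin_le_nhds
  rw [ContinuousMap.tendsto_iff_tendstoLocallyUniformly, ← tendstoLocallyUniformlyOn_univ] at ht
  have hev : ∀ᶠ h : C(ℂ, ℂ) in 𝓝[{g : C(ℂ, ℂ) | Differentiable ℂ g}] g,
      DifferentiableOn ℂ h Set.univ := by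
    filter_upwards [self_mem_nhdsWithin] with h hh
    exact Differentiable.differentiableOn hh
  exact differentiableOn_univ.1 (ht.differentiableOn hev isOpen_univ)

instance EntireFunctions.baireSpace : BaireSpace EntireFunctions := by
  have : CompleteSpace EntireFunctions := isClosed_setOf_differentiable.completeSpace_coe
  have : (uniformity EntireFunctions).IsCountablyGenerated := by
    rw [uniformity_subtype]
    infer_instance
  infer_instance

/-- Universality for `H(⋃ n, U n)` is generic. -/
theorem isComeagre_isUniversalForComposition {f : ℂ → ℂ} (hf : Differentiable ℂ f)
    {U : ℕ → Set ℂ} (hU : ∀ n, IsOpen (U n)) (hUc : ∀ n, IsSimplyConnected (U n))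
    (hd : Pairwise fun i j => Disjoint (U i) (U j))
    (hmaps : ∀ n, Set.MapsTo f (U n) (U (n + 1))) (hinj : ∀ n, Set.InjOn f (U n))
    (hinf : ∀ n, ∃ φ : ℕ → ℕ, TendsToInftyLocallyUniformlyOn (fun j => f^[φ j]) (U n)) :
    IsComeagre {g : EntireFunctions |
      IsUniversalForComposition f (holomorphicFunctions (⋃ n, U n)) g} := by
  set M := ⋃ n, U n with hMdef
  have hM : IsOpen M := isOpen_iUnion hU
  have : LocallyCompactSpace M := hM.locallyCompactSpace
  let ι : ℕ → C(M, ℂ) := fun n => ⟨fun z => f^[n] z,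
    (hf.continuous.iterate n).comp continuous_subtype_val⟩
  let r : ℕ → EntireFunctions → C(M, ℂ) := fun n g => g.1.comp (ι n)
  have hr : ∀ n, Continuous (r n) := fun n =>
    (ContinuousMap.continuous_precomp (ι n)).comp continuous_subtype_val
  -- Only basic open sets meeting `H(M)` matter: `g` is universal as soon as its orbit `r n g`
  -- enters each of these countably many sets. Each gives an open condition on `g`, dense by
  -- simultaneous approximation.
  let S : Set (Set C(M, ℂ)) :=
    {B ∈ TopologicalSpace.countableBasis C(M, ℂ) | (B ∩ holomorphicFunctions M).Nonempty}
  have hSopen : ∀ B ∈ S, IsOpen B := fun B hB => TopologicalSpace.isOpen_of_mem_countableBasis hB.1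
  have hSc : S.Countable :=
    (TopologicalSpace.countable_countableBasis C(M, ℂ)).mono fun B hB => hB.1
  have hopen : ∀ B ∈ S, IsOpen (⋃ n, r n ⁻¹' B) := fun B hB =>
    isOpen_iUnion fun n => (hSopen B hB).preimage (hr n)
  refine ⟨⋂ B ∈ S, ⋃ n, r n ⁻¹' B, ?_, ?_, ?_⟩
  · intro g hg h hh
    rw [(TopologicalSpace.isBasis_countableBasis C(M, ℂ)).mem_closure_iff]
    intro B hB hhB
    obtain ⟨n, hn⟩ := Set.mem_iUnion.1 (Set.mem_iInter₂.1 hg B ⟨hB, h, hhB, hh⟩)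
    exact ⟨r n g, hn, n, fun z => rfl⟩
  · exact IsGδ.biInter hSc fun B hB => (hopen B hB).isGδ
  · refine dense_biInter_of_isOpen hopen hSc fun B hB => ?_
    rw [dense_iff_inter_open]
    rintro O hO ⟨g, hgO⟩
    obtain ⟨O', hO', rfl⟩ := isOpen_induced_iff.1 hO
    obtain ⟨h, hhB, H, hH, hhH⟩ := hB.2
    obtain ⟨K, hK, ε, hε, hKO⟩ := exists_isCompact_forall_norm_sub_lt_mem hO' hgO
    obtain ⟨K', hK', ε', hε', hKB⟩ := exists_isCompact_forall_norm_sub_lt_mem (hSopen B hB) hhB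
    obtain ⟨R, hR⟩ := hK.isBounded.subset_closedBall 0
    obtain ⟨p, n, hp, hpn⟩ := exists_polynomial_approx_and_comp_iterate_approx hf hU hUc hd hmaps
      hinj hinf (hK'.image continuous_subtype_val) (Subtype.coe_image_subset M K') g.2 hH R
      (lt_min hε hε')
    refine ⟨⟨⟨fun z => p.eval z, p.continuous⟩, p.differentiable⟩, ?_, ?_⟩
    · exact hKO _ fun z hz =>
        (hp z (mem_closedBall_zero_iff.1 (hR hz))).trans_le (min_le_left _ _)
    · refine Set.mem_iUnion.2 ⟨n, hKB _ fun z hz => ?_⟩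
      rw [hhH z]
      exact (hpn z ⟨z, hz, rfl⟩).trans_le (min_le_right _ _)

theorem mainTheorem2 (f : ℂ → ℂ) (hf : IsTranscendentalEntire f) (U : ℕ → Set ℂ)
    (hmaps : ∀ n, Set.MapsTo f (U n) (U (n + 1)))
    (hosc : ∀ n, IsOscillatingWanderingDomain f (U n))
    (hiso : ∀ n, IsEventuallyIsometricWanderingDomain f (U n)) :
    (∃ N : ℕ, ∀ n ≥ N, Set.InjOn f (U n)) ∧
      ∀ N : ℕ, (∀ n ≥ N, Set.InjOn f (U n)) →
        IsComeagre {g : EntireFunctions |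
          IsUniversalForComposition f (holomorphicFunctions (⋃ n ≥ N, U n)) g} := by
  refine ⟨exists_forall_ge_injOn_of_isEventuallyIsometric hf hmaps hiso, fun N hN => ?_⟩
  have hd := pairwise_disjoint_of_isWanderingDomain hmaps fun n => (hosc n).1
  -- Shifting the index by `N` yields a sequence of domains on all of which `f` is injective.
  have hM : (⋃ n ≥ N, U n) = ⋃ n, U (N + n) := by
    ext z
    simp only [Set.mem_iUnion, exists_prop]
    constructor
    · rintro ⟨n, hn, hz⟩
      exact ⟨n - N, by rwa [Nat.add_sub_cancel' hn]⟩
    · rintro ⟨n, hz⟩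
      exact ⟨N + n, Nat.le_add_right _ _, hz⟩
  rw [hM]
  refine isComeagre_isUniversalForComposition hf.1 (fun n => (hosc (N + n)).1.1.isOpen)
    (fun n => (hiso (N + n)).2.1) (fun i j hij => hd (by omega)) (fun n => hmaps (N + n))
    (fun n => hN _ (Nat.le_add_right _ _)) fun n => ?_
  obtain ⟨φ, -, hφ⟩ := (hosc (N + n)).2.1
  exact ⟨φ, hφ⟩
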